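/- Let $\mathcal H$ be a complex Hilbert space, $A$ a (possibly unbounded) self-adjoint operator on $\mathcal H$ with domain $\mathcal D(A)$, and $\langle A\rangle=\sqrt{A^2+1}$; for $m\in\mathbb Z$ put $\langle m\rangle=\sqrt{m^2+1}$. A bounded operator $B$ on $\mathcal H$ is of class $C^1(A)$ if the form $(\varphi,\psi)\mapsto\langle A\varphi,B\psi\rangle-\langle\varphi,BA\psi\rangle$ on $\mathcal D(A)\times\mathcal D(A)$ extends to a bounded form on $\mathcal H\times\mathcal H$; the bounded operator associated with the extension is denoted $\mathrm{ad}_A B$. For $k\in\mathbb N$, $B\in C^k(A)$ means that $\mathrm{ad}_A^{\,j}B\in C^1(A)$ for all $0\le j<k$ (with $\mathrm{ad}_A^0B=B$), and $B\in C^\infty(A)$ means $B\in C^k(A)$ for all $k$. Let $U$ be a unitary operator on $\mathcal H$ with spectral family $(E_\Delta)$, indexed by the Borel subsets $\Delta$ of the unit circle $\mathbb S\cong\mathbb T$, and let $\sigma_{pp}(U)\subset\mathbb S$ be its set of eigenvalues. If $U\in C^1(A)$, write $U^*AU-A$ for the bounded operator $U^*(\mathrm{ad}_AU)$. One says that $U$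 is propagating with respect to $A$ on a Borel set $\Theta\subset\mathbb S$ if $U\in C^1(A)$ and there are $c>0$ and a compact operator $K$ such that $E_\Theta(U^*AU-A)E_\Theta\ge cE_\Theta+K$. **Corollary.** Let $\Theta\subset\mathbb S$ be open. Assume that $U\in C^\infty(A)$, that $U$ is propagating with respect to $A$ on $\Theta$, and that $\Phi\in C_0^\infty(\Theta\setminus\sigma_{pp}(U))$, i.e. $\Phi:\mathbb S\to\mathbb C$ is smooth and its support is contained in $\Theta\setminus\sigma_{pp}(U)$. Then for all real $0<s'<s$ there exists $C>0$ such that for all $m\in\mathbb Z$ $$\big\|\langle A\rangle^{-s}\,U^m\,\Phi(U)\,\langle A\rangle^{-s}\big\|\le C\,\langle m\rangle^{-s'} .$$ -/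

import Mathlib

open scoped InnerProductSpace CompactlySupported ContDiff

noncomputable section

namespace UnitaryMourre

variable {H : Type*} [NormedAddCommGroup H] [InnerProductSpace ℂ H] [CompleteSpace H]

/-! ### Continuous functional calculus and spectral family of a unitary operator -/

/-- The inclusion of the spectrum of the unitary operator `U` into the unit circle. -/
def spectrumToCircle (U : unitary (H →L[ℂ] H)) : C(spectrum ℂ (U : H →L[ℂ] H), Circle) where
  toFun z := ⟨z.1, mem_sphere_zero_iff_norm.mpr
    (spectrum.norm_eq_one_of_unitary (𝕜 := ℂ) U.2 z.2)⟩
  continuous_toFun := Continuous.subtype_mk continuous_subtype_val _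

/-- The functional calculus `Φ ↦ Φ(U)` for continuous functions `Φ` on the unit circle. -/
def funCalc (U : unitary (H →L[ℂ] H)) : C(Circle, ℂ) →⋆ₐ[ℂ] (H →L[ℂ] H) :=
  (cfcHom (R := ℂ) (a := (U : H →L[ℂ] H)) (inferInstanceAs (IsStarNormal (U : H →L[ℂ] H)))).comp
    (ContinuousMap.compStarAlgHom' ℂ ℂ (spectrumToCircle U))

/-- A real continuous function on the circle, seen as a complex one. -/
def toComplexFun (f : C_c(Circle, ℝ)) : C(Circle, ℂ) where
  toFun z := (f z : ℂ)
  continuous_toFun := Complex.continuous_ofReal.comp f.continuous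


/-- The positive functional `f ↦ ⟪ψ, f(U) ψ⟫`. -/
def spectralFunctional (U : unitary (H →L[ℂ] H)) (ψ : H) : C_c(Circle, ℝ) →ₚ[ℝ] ℝ :=
  PositiveLinearMap.mk₀
    { toFun := fun f => (⟪ψ, funCalc U (toComplexFun f) ψ⟫_ℂ).re
      map_add' := by
        intro f g
        have : toComplexFun (f + g) = toComplexFun f + toComplexFun g := by
          ext z; simp [toComplexFun]
        rw [this, map_add]
        simp
      map_smul' := by
        intro c f
        have : toComplexFun (c • f) = (c : ℂ) • toComplexFun f := by
          ext z; simp [toComplexFun]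
        rw [this, map_smul]
        simp }
    (by
      intro f hf
      let g : C(Circle, ℂ) :=
        ⟨fun z => (Real.sqrt (f z) : ℂ),
          Complex.continuous_ofReal.comp (Real.continuous_sqrt.comp f.continuous)⟩
      have hg : toComplexFun f = star g * g := by
        ext z
        have h0 : (0 : ℝ) ≤ f z := hf z
        simp only [toComplexFun, g, ContinuousMap.mul_apply, ContinuousMap.star_apply,
          ContinuousMap.coe_mk, RCLike.star_def, Complex.conj_ofReal]
        rw [← Complex.ofReal_mul, Real.mul_self_sqrt h0]
      change 0 ≤ (⟪ψ, funCalc U (toComplexFun f) ψ⟫_ℂ).re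
      rw [hg, map_mul, map_star, ContinuousLinearMap.star_eq_adjoint,
        mul_apply_eq_comp, ContinuousLinearMap.adjoint_inner_right]
      exact inner_self_nonneg (𝕜 := ℂ))

instance instMeasurableSpaceCircle : MeasurableSpace Circle := borel Circle

instance instBorelSpaceCircle : BorelSpace Circle := ⟨rfl⟩

/-- The scalar spectral measure of `U` at `ψ`: the measure on the circle that represents
`f ↦ ⟪ψ, f(U) ψ⟫`. -/
def spectralMeasure (U : unitary (H →L[ℂ] H)) (ψ : H) : MeasureTheory.Measure Circle :=
  RealRMK.rieszMeasure (spectralFunctional U ψ)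

instance instIsFiniteMeasureSpectralMeasure (U : unitary (H →L[ℂ] H)) (ψ : H) :
    MeasureTheory.IsFiniteMeasure (spectralMeasure U ψ) := by
  unfold spectralMeasure; infer_instance

theorem spectralFunctional_apply (U : unitary (H →L[ℂ] H)) (ψ : H) (f : C_c(Circle, ℝ)) :
    spectralFunctional U ψ f = (⟪ψ, funCalc U (toComplexFun f) ψ⟫_ℂ).re := rfl

theorem integral_spectralMeasure (U : unitary (H →L[ℂ] H)) (ψ : H) (f : C_c(Circle, ℝ)) :
    ∫ z, f z ∂(spectralMeasure U ψ) = (⟪ψ, funCalc U (toComplexFun f) ψ⟫_ℂ).re :=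
  RealRMK.integral_rieszMeasure (spectralFunctional U ψ) f

/-- A linear relation between the functionals `f ↦ ⟪ψ, f(U) ψ⟫` passes to the measures. -/
theorem spectralMeasure_relation (U : unitary (H →L[ℂ] H)) {ι : Type*} [Fintype ι]
    (c : ι → ℝ) (v : ι → H)
    (h : ∀ f : C_c(Circle, ℝ), ∑ i, c i * (⟪v i, funCalc U (toComplexFun f) (v i)⟫_ℂ).re = 0)
    (Δ : Set Circle) :
    ∑ i, c i * (spectralMeasure U (v i)).real Δ = 0 := by
  let P : MeasureTheory.Measure Circle := ∑ i, (c i).toNNReal • spectralMeasure U (v i)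
  let N : MeasureTheory.Measure Circle := ∑ i, (-c i).toNNReal • spectralMeasure U (v i)
  have hint : ∀ (d : ι → NNReal) (f : C_c(Circle, ℝ)),
      ∫ z, f z ∂(∑ i, d i • spectralMeasure U (v i)) =
        ∑ i, (d i : ℝ) * (⟪v i, funCalc U (toComplexFun f) (v i)⟫_ℂ).re := by
    intro d f
    rw [MeasureTheory.integral_finsetSum_measure (fun i _ => f.integrable)]
    refine Finset.sum_congr rfl fun i _ => ?_
    rw [MeasureTheory.integral_smul_nnreal_measure, integral_spectralMeasure]
    rfl
  have hreal : ∀ (d : ι → NNReal), (∑ i, d i • spectralMeasure U (v i)).real Δ =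
        ∑ i, (d i : ℝ) * (spectralMeasure U (v i)).real Δ := by
    intro d
    rw [MeasureTheory.measureReal_def, MeasureTheory.Measure.finsetSum_apply,
      ENNReal.toReal_sum (fun i _ => by finiteness)]
    refine Finset.sum_congr rfl fun i _ => ?_
    simp [MeasureTheory.measureReal_def]
  have hd : ∀ i, c i = ((c i).toNNReal : ℝ) - ((-c i).toNNReal : ℝ) := by
    intro i
    rw [Real.coe_toNNReal', Real.coe_toNNReal']
    exact (max_zero_sub_max_neg_zero_eq_self (c i)).symm
  have hPN : P = N := by
    refine MeasureTheory.Measure.ext_of_integral_eq_on_compactlySupported fun f => ?_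
    rw [hint, hint, ← sub_eq_zero, ← Finset.sum_sub_distrib, ← h f]
    refine Finset.sum_congr rfl fun i _ => ?_
    rw [← sub_mul, ← hd]
  have h2 : P.real Δ = N.real Δ := by rw [hPN]
  rw [hreal, hreal, ← sub_eq_zero, ← Finset.sum_sub_distrib] at h2
  rw [← h2]
  refine Finset.sum_congr rfl fun i _ => ?_
  rw [← sub_mul, ← hd]

/-- Real polarization of `ψ ↦ μ_ψ(Δ)`. -/
def polar (U : unitary (H →L[ℂ] H)) (Δ : Set Circle) (φ ψ : H) : ℝ :=
  ((spectralMeasure U (φ + ψ)).real Δ - (spectralMeasure U (φ - ψ)).real Δ) / 4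

theorem inner_funCalc_symm (U : unitary (H →L[ℂ] H)) (f : C_c(Circle, ℝ)) (φ ψ : H) :
    (⟪ψ, funCalc U (toComplexFun f) φ⟫_ℂ).re = (⟪φ, funCalc U (toComplexFun f) ψ⟫_ℂ).re := by
  have hs : star (toComplexFun f) = toComplexFun f := by
    ext z; simp [toComplexFun]
  have h1 : ContinuousLinearMap.adjoint (funCalc U (toComplexFun f)) =
      funCalc U (toComplexFun f) := by
    rw [← ContinuousLinearMap.star_eq_adjoint, ← map_star, hs]
  rw [← ContinuousLinearMap.adjoint_inner_left, h1, ← inner_conj_symm, Complex.conj_re]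

theorem polar_relation (U : unitary (H →L[ℂ] H)) {ι : Type*} [Fintype ι]
    (c : ι → ℝ) (v w : ι → H)
    (h : ∀ f : C_c(Circle, ℝ), ∑ i, c i * (⟪v i, funCalc U (toComplexFun f) (w i)⟫_ℂ).re = 0)
    (Δ : Set Circle) :
    ∑ i, c i * polar U Δ (v i) (w i) = 0 := by
  have key := spectralMeasure_relation U (Sum.elim (fun i => c i / 4) (fun i => -c i / 4))
    (Sum.elim (fun i => v i + w i) (fun i => v i - w i)) (by
      intro f
      rw [← h f, Fintype.sum_sum_type, ← Finset.sum_add_distrib]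
      refine Finset.sum_congr rfl fun i _ => ?_
      simp only [Sum.elim_inl, Sum.elim_inr, map_add, map_sub, inner_add_left, inner_add_right,
        inner_sub_left, inner_sub_right, Complex.add_re, Complex.sub_re]
      rw [inner_funCalc_symm U f (v i) (w i)]
      ring) Δ
  rw [← key, Fintype.sum_sum_type, ← Finset.sum_add_distrib]
  refine Finset.sum_congr rfl fun i _ => ?_
  simp only [Sum.elim_inl, Sum.elim_inr, polar]
  ring

theorem polar_comm (U : unitary (H →L[ℂ] H)) (Δ : Set Circle) (φ ψ : H) :
    polar U Δ φ ψ = polar U Δ ψ φ := by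
  have := polar_relation U ![1, -1] ![φ, ψ] ![ψ, φ] (by
    intro f
    simp [Fin.sum_univ_two, inner_funCalc_symm U f φ ψ]) Δ
  simp [Fin.sum_univ_two] at this
  linarith

theorem polar_add_right (U : unitary (H →L[ℂ] H)) (Δ : Set Circle) (φ ψ χ : H) :
    polar U Δ φ (ψ + χ) = polar U Δ φ ψ + polar U Δ φ χ := by
  have := polar_relation U ![1, -1, -1] ![φ, φ, φ] ![ψ + χ, ψ, χ] (by
    intro f
    simp [Fin.sum_univ_three]) Δ
  simp [Fin.sum_univ_three] at this
  linarith

theorem polar_smul_right (U : unitary (H →L[ℂ] H)) (Δ : Set Circle) (c : ℂ) (φ ψ : H) :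
    polar U Δ φ (c • ψ) = c.re * polar U Δ φ ψ + c.im * polar U Δ φ (Complex.I • ψ) := by
  have := polar_relation U ![1, -c.re, -c.im] ![φ, φ, φ] ![c • ψ, ψ, Complex.I • ψ] (by
    intro f
    simp [Fin.sum_univ_three]
    ring) Δ
  simp [Fin.sum_univ_three] at this
  linarith

theorem polar_I_left (U : unitary (H →L[ℂ] H)) (Δ : Set Circle) (φ ψ : H) :
    polar U Δ (Complex.I • φ) ψ = - polar U Δ φ (Complex.I • ψ) := by
  have := polar_relation U ![1, 1] ![Complex.I • φ, φ] ![ψ, Complex.I • ψ] (by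
    intro f
    simp [Fin.sum_univ_two]) Δ
  simp [Fin.sum_univ_two] at this
  linarith

theorem polar_self (U : unitary (H →L[ℂ] H)) (Δ : Set Circle) (ψ : H) :
    polar U Δ ψ ψ = (spectralMeasure U ψ).real Δ := by
  have := spectralMeasure_relation U ![1, -1, -4] ![ψ + ψ, ψ - ψ, ψ] (by
    intro f
    simp [Fin.sum_univ_three]
    ring) Δ
  simp [Fin.sum_univ_three] at this
  simp [polar]
  linarith

theorem polar_self_I (U : unitary (H →L[ℂ] H)) (Δ : Set Circle) (ψ : H) :
    polar U Δ ψ (Complex.I • ψ) = 0 := by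
  have h1 := polar_I_left U Δ ψ ψ
  rw [polar_comm] at h1
  linarith

theorem spectralMeasure_real_le (U : unitary (H →L[ℂ] H)) (Δ : Set Circle) (ψ : H) :
    (spectralMeasure U ψ).real Δ ≤ ‖ψ‖ ^ 2 := by
  refine (MeasureTheory.measureReal_mono (Set.subset_univ Δ)).trans (le_of_eq ?_)
  let o : C_c(Circle, ℝ) := ⟨1, HasCompactSupport.of_compactSpace 1⟩
  have h1 := integral_spectralMeasure U ψ o
  have h2 : toComplexFun o = 1 := by
    ext z
    exact Complex.ofReal_one
  have h3 : ∀ z, o z = 1 := fun z => rfl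
  rw [h2, map_one] at h1
  simp only [h3, MeasureTheory.integral_const, smul_eq_mul, mul_one] at h1
  rw [h1, one_apply_eq_self]
  exact inner_self_eq_norm_sq (𝕜 := ℂ) ψ

theorem abs_polar_le (U : unitary (H →L[ℂ] H)) (Δ : Set Circle) (φ ψ : H) :
    |polar U Δ φ ψ| ≤ ‖φ‖ * ‖ψ‖ := by
  have hq : ∀ φ ψ : H, |polar U Δ φ ψ| ≤ (‖φ‖ ^ 2 + ‖ψ‖ ^ 2) / 2 := by
    intro φ ψ
    have h1 := spectralMeasure_real_le U Δ (φ + ψ)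
    have h2 := spectralMeasure_real_le U Δ (φ - ψ)
    have h3 : 0 ≤ (spectralMeasure U (φ + ψ)).real Δ := MeasureTheory.measureReal_nonneg
    have h4 : 0 ≤ (spectralMeasure U (φ - ψ)).real Δ := MeasureTheory.measureReal_nonneg
    have h5 := parallelogram_law_with_norm ℂ φ ψ
    rw [polar, abs_le]
    constructor <;> nlinarith
  have hs : ∀ (r t : ℝ) (φ ψ : H),
      polar U Δ ((r : ℂ) • φ) ((t : ℂ) • ψ) = r * t * polar U Δ φ ψ := by
    intro r t φ ψ
    rw [polar_smul_right, polar_comm U Δ ((r : ℂ) • φ) ψ, polar_smul_right, polar_comm U Δ ψ φ]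
    simp
    ring
  rcases eq_or_ne φ 0 with rfl | hφ
  · have := hs 0 1 0 ψ
    simp at this
    simp [this]
  rcases eq_or_ne ψ 0 with rfl | hψ
  · have := hs 1 0 φ 0
    simp at this
    simp [this]
  have hφ' : 0 < ‖φ‖ := norm_pos_iff.mpr hφ
  have hψ' : 0 < ‖ψ‖ := norm_pos_iff.mpr hψ
  have h1 := hq (((‖φ‖⁻¹ : ℝ) : ℂ) • φ) (((‖ψ‖⁻¹ : ℝ) : ℂ) • ψ)
  rw [hs, norm_smul, norm_smul, Complex.norm_real, Complex.norm_real, norm_inv, norm_inv,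
    norm_norm, norm_norm, inv_mul_cancel₀ hφ'.ne', inv_mul_cancel₀ hψ'.ne', abs_mul, abs_mul,
    abs_of_pos (inv_pos.mpr hφ'), abs_of_pos (inv_pos.mpr hψ'), ← mul_inv] at h1
  rw [inv_mul_le_iff₀ (by positivity)] at h1
  linarith

/-- For every Borel set `Δ` there is a bounded operator whose quadratic form is
`ψ ↦ μ_ψ(Δ)`. -/
theorem exists_spectralProj (U : unitary (H →L[ℂ] H)) (Δ : Set Circle) :
    ∃ E : H →L[ℂ] H, ∀ ψ : H, ⟪ψ, E ψ⟫_ℂ = ((spectralMeasure U ψ).real Δ : ℂ) := by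
  have hadd : ∀ φ χ ψ, polar U Δ (φ + χ) ψ = polar U Δ φ ψ + polar U Δ χ ψ := by
    intro φ χ ψ
    rw [polar_comm, polar_add_right, polar_comm U Δ ψ φ, polar_comm U Δ ψ χ]
  have hII : ∀ φ ψ, polar U Δ φ (Complex.I • Complex.I • ψ) = - polar U Δ φ ψ := by
    intro φ ψ
    have h : Complex.I • Complex.I • ψ = (-1 : ℂ) • ψ := by rw [smul_smul, Complex.I_mul_I]
    rw [h, polar_smul_right]
    simp
  let B : H →ₗ⋆[ℂ] H →ₗ[ℂ] ℂ := LinearMap.mk₂'ₛₗ (starRingEnd ℂ) (RingHom.id ℂ)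
    (fun φ ψ => (polar U Δ φ ψ : ℂ) - Complex.I * (polar U Δ φ (Complex.I • ψ) : ℂ))
    (by
      intro φ χ ψ
      rw [hadd, hadd]; push_cast; ring)
    (by
      intro c φ ψ
      have hl : ∀ χ, polar U Δ (c • φ) χ =
          c.re * polar U Δ φ χ - c.im * polar U Δ φ (Complex.I • χ) := by
        intro χ
        rw [polar_comm, polar_smul_right, polar_comm U Δ χ φ,
          polar_comm U Δ χ (Complex.I • φ), polar_I_left]
        ring
      rw [hl, hl, hII]
      apply Complex.ext <;> simp <;> ring)
    (by
      intro φ ψ χ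
      rw [smul_add, polar_add_right, polar_add_right]; push_cast; ring)
    (by
      intro c φ ψ
      rw [smul_comm Complex.I c ψ, polar_smul_right, polar_smul_right U Δ c φ (Complex.I • ψ), hII]
      apply Complex.ext <;> simp <;> ring)
  have hB : ∀ φ ψ, ‖B φ ψ‖ ≤ 2 * ‖φ‖ * ‖ψ‖ := by
    intro φ ψ
    change ‖(polar U Δ φ ψ : ℂ) - Complex.I * (polar U Δ φ (Complex.I • ψ) : ℂ)‖ ≤ _
    refine (norm_sub_le _ _).trans ?_
    rw [norm_mul, Complex.norm_I, one_mul, Complex.norm_real, Complex.norm_real,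
      Real.norm_eq_abs, Real.norm_eq_abs]
    have h1 := abs_polar_le U Δ φ ψ
    have h2 := abs_polar_le U Δ φ (Complex.I • ψ)
    rw [norm_smul, Complex.norm_I, one_mul] at h2
    linarith
  let E' := InnerProductSpace.continuousLinearMapOfBilin (B.mkContinuous₂ 2 hB)
  refine ⟨E', fun ψ => ?_⟩
  have h1 : ⟪E' ψ, ψ⟫_ℂ = B ψ ψ := InnerProductSpace.continuousLinearMapOfBilin_apply _ ψ ψ
  have h2 : B ψ ψ = ((spectralMeasure U ψ).real Δ : ℂ) := by
    change (polar U Δ ψ ψ : ℂ) - Complex.I * (polar U Δ ψ (Complex.I • ψ) : ℂ) = _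
    rw [polar_self_I, polar_self]; simp
  rw [← inner_conj_symm, h1, h2, Complex.conj_ofReal]

/-- The spectral projection `E_Δ` of `U`: the operator with `⟪ψ, E_Δ ψ⟫ = μ_ψ(Δ)` for all `ψ`,
where `μ_ψ` is the scalar spectral measure of `U` at `ψ`. -/
def spectralProj (U : unitary (H →L[ℂ] H)) (Δ : Set Circle) : H →L[ℂ] H :=
  Classical.choose (exists_spectralProj U Δ)

theorem inner_spectralProj (U : unitary (H →L[ℂ] H)) (Δ : Set Circle) (ψ : H) :
    ⟪ψ, spectralProj U Δ ψ⟫_ℂ = ((spectralMeasure U ψ).real Δ : ℂ) :=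
  Classical.choose_spec (exists_spectralProj U Δ) ψ

/-- The set `σ_pp(U)` of eigenvalues of `U`, as a subset of the circle. -/
def pointSpectrum (U : unitary (H →L[ℂ] H)) : Set Circle :=
  {z | Module.End.HasEigenvalue ((U : H →L[ℂ] H) : H →ₗ[ℂ] H) (z : ℂ)}

/-! ### Negative powers of `⟨A⟩` for a self-adjoint operator `A` -/

/-- `R` is the bounded inverse `(A² + 1)⁻¹`: it maps into the domain of `A²` and
`(A² + 1) R = 1`, `R (A² + 1) = 1`. -/
def IsInvSqAddOne (A : H →ₗ.[ℂ] H) (R : H →L[ℂ] H) : Prop :=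
  (∀ y : H, ∃ (h₁ : R y ∈ A.domain) (h₂ : A ⟨R y, h₁⟩ ∈ A.domain), A ⟨_, h₂⟩ + R y = y) ∧
  ∀ (x : A.domain) (h : A x ∈ A.domain), R (A ⟨A x, h⟩ + x) = x

theorem exists_isInvSqAddOne {A : H →ₗ.[ℂ] H} (hA : IsSelfAdjoint A) :
    ∃ R : H →L[ℂ] H, IsInvSqAddOne A R := by
  have hd := hA.dense_domain
  have hAA : A.adjoint = A := LinearPMap.isSelfAdjoint_def.mp hA
  have hsymm : ∀ x y : A.domain, ⟪A x, (y : H)⟫_ℂ = ⟪(x : H), A y⟫_ℂ := by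
    have h := LinearPMap.adjoint_isFormalAdjoint (T := A) hd
    rw [hAA] at h
    exact fun x y => h x y
  have hmem : ∀ (y w : H), (∀ x : A.domain, ⟪w, (x : H)⟫_ℂ = ⟪y, A x⟫_ℂ) →
      ∃ hy : y ∈ A.domain, A ⟨y, hy⟩ = w := by
    intro y w h
    have hy : y ∈ A.adjoint.domain := LinearPMap.mem_adjoint_domain_of_exists y ⟨w, h⟩
    have hw := LinearPMap.adjoint_apply_eq hd ⟨y, hy⟩ h
    have aux : ∀ T : H →ₗ.[ℂ] H, T = A → ∀ h' : y ∈ T.domain, T ⟨y, h'⟩ = w →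
        ∃ hy : y ∈ A.domain, A ⟨y, hy⟩ = w := by
      rintro T rfl h' hw; exact ⟨h', hw⟩
    exact aux _ hAA hy hw
  -- the graph of `A`, as a closed subspace of the Hilbert space `H ⊕ H`
  let e : WithLp 2 (H × H) ≃L[ℂ] H × H := WithLp.prodContinuousLinearEquiv 2 ℂ H H
  let G : Submodule ℂ (WithLp 2 (H × H)) := A.graph.comap (e : WithLp 2 (H × H) →ₗ[ℂ] H × H)
  have hGc : IsClosed (G : Set (WithLp 2 (H × H))) := by
    have : IsClosed (A.graph : Set (H × H)) := hA.isClosed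
    exact this.preimage e.continuous
  have : CompleteSpace G := hGc.completeSpace_coe
  let R : H →L[ℂ] H := (ContinuousLinearMap.fst ℂ H H).comp
    ((e : WithLp 2 (H × H) →L[ℂ] H × H).comp (G.starProjection.comp
      ((e.symm : H × H →L[ℂ] WithLp 2 (H × H)).comp (ContinuousLinearMap.inl ℂ H H))))
  have hright : ∀ y : H, ∃ (h₁ : R y ∈ A.domain) (h₂ : A ⟨R y, h₁⟩ ∈ A.domain),
      A ⟨_, h₂⟩ + R y = y := by
    intro y
    set p : WithLp 2 (H × H) := G.starProjection (e.symm (y, 0)) with hp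
    have hpG : e p ∈ A.graph := G.starProjection_apply_mem _
    have hR : R y = (e p).1 := rfl
    obtain ⟨x, hx1, hx2⟩ := (LinearPMap.mem_graph_iff A).mp hpG
    have hperp : ∀ z : A.domain, ⟪y - (x : H), (z : H)⟫_ℂ = ⟪A x, A z⟫_ℂ := by
      intro z
      have hz : e.symm ((z : H), A z) ∈ G := by
        change e (e.symm ((z : H), A z)) ∈ A.graph
        rw [ContinuousLinearEquiv.apply_symm_apply]
        exact A.mem_graph z
      have h := G.starProjection_inner_eq_zero (e.symm (y, 0)) _ hz
      rw [← hp, WithLp.prod_inner_apply] at h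
      have h' : ⟪y - (e p).1, (z : H)⟫_ℂ + ⟪0 - (e p).2, A z⟫_ℂ = 0 := h
      rw [← hx1, ← hx2, zero_sub, inner_neg_left] at h'
      exact add_neg_eq_zero.mp h'
    obtain ⟨h₂, h₃⟩ := hmem (A x) (y - x) hperp
    have hRx : R y = x := by rw [hR, hx1]
    have h₁ : R y ∈ A.domain := by rw [hRx]; exact x.2
    have hxe : (⟨R y, h₁⟩ : A.domain) = x := Subtype.ext hRx
    refine ⟨h₁, by rw [hxe]; exact h₂, ?_⟩
    have : ∀ (x' : A.domain) (h : A x' ∈ A.domain), x' = x → A ⟨A x', h⟩ = y - x := by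
      rintro x' h rfl; exact h₃
    rw [this _ _ hxe, hRx]
    simp
  have hinj : ∀ (x : A.domain) (h : A x ∈ A.domain), A ⟨A x, h⟩ + x = 0 → (x : H) = 0 := by
    intro x h h0
    have h1 : ⟪A ⟨A x, h⟩ + (x : H), (x : H)⟫_ℂ = 0 := by rw [h0, inner_zero_left]
    rw [inner_add_left, hsymm] at h1
    have h2 := congrArg Complex.re h1
    have h3 : 0 ≤ (⟪A x, A x⟫_ℂ).re := inner_self_nonneg (𝕜 := ℂ)
    have h4 : (⟪(x : H), (x : H)⟫_ℂ).re = ‖(x : H)‖ ^ 2 := inner_self_eq_norm_sq (𝕜 := ℂ) _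
    simp only [Complex.add_re, Complex.zero_re] at h2
    have h5 : ‖(x : H)‖ ^ 2 ≤ 0 := by rw [← h4]; linarith
    exact norm_eq_zero.mp (pow_eq_zero_iff (two_ne_zero) |>.mp (le_antisymm h5 (by positivity)))
  refine ⟨R, hright, fun x h => ?_⟩
  obtain ⟨h₁, h₂, h₃⟩ := hright (A ⟨A x, h⟩ + x)
  set y : A.domain := ⟨_, h₁⟩ with hy
  have hsub : A (y - x) = A y - A x := A.map_sub y x
  have hm : A (y - x) ∈ A.domain := by rw [hsub]; exact A.domain.sub_mem h₂ h
  have h6 : A ⟨A (y - x), hm⟩ = A ⟨A y, h₂⟩ - A ⟨A x, h⟩ := by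
    rw [← LinearPMap.map_sub]
    congr 1
    exact Subtype.ext hsub
  have h7 := hinj (y - x) hm (by
    rw [h6, Submodule.coe_sub, sub_add_sub_comm, sub_eq_zero]
    exact h₃)
  exact sub_eq_zero.mp h7

open Classical in
/-- The bounded operator `(A² + 1)⁻¹` of a self-adjoint operator `A`. -/
def invSqAddOne (A : H →ₗ.[ℂ] H) : H →L[ℂ] H :=
  if h : ∃ R : H →L[ℂ] H, IsInvSqAddOne A R then Classical.choose h else 0

theorem invSqAddOne_spec {A : H →ₗ.[ℂ] H} (hA : IsSelfAdjoint A) :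
    IsInvSqAddOne A (invSqAddOne A) := by
  unfold invSqAddOne
  rw [dif_pos (exists_isInvSqAddOne hA)]
  exact Classical.choose_spec (exists_isInvSqAddOne hA)

theorem invSqAddOne_nonneg {A : H →ₗ.[ℂ] H} (hA : IsSelfAdjoint A) : 0 ≤ invSqAddOne A := by
  have hd := hA.dense_domain
  have hsymm : ∀ x y : A.domain, ⟪A x, (y : H)⟫_ℂ = ⟪(x : H), A y⟫_ℂ := by
    have h := LinearPMap.adjoint_isFormalAdjoint (T := A) hd
    rw [LinearPMap.isSelfAdjoint_def.mp hA] at h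
    exact fun x y => h x y
  rw [ContinuousLinearMap.nonneg_iff_isPositive, ContinuousLinearMap.isPositive_iff_complex]
  intro y
  obtain ⟨h₁, h₂, h₃⟩ := (invSqAddOne_spec hA).1 y
  set x : A.domain := ⟨invSqAddOne A y, h₁⟩ with hx
  have hy : y = A ⟨A x, h₂⟩ + x := h₃.symm
  have key : ⟪(x : H), y⟫_ℂ = ((‖A x‖ ^ 2 + ‖(x : H)‖ ^ 2 : ℝ) : ℂ) := by
    have h4 : ⟪(x : H), A ⟨A x, h₂⟩⟫_ℂ = ⟪A x, A x⟫_ℂ := (hsymm x ⟨A x, h₂⟩).symm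
    calc ⟪(x : H), y⟫_ℂ = ⟪(x : H), A ⟨A x, h₂⟩ + x⟫_ℂ := congrArg _ hy
      _ = _ := by
        rw [inner_add_right, h4, inner_self_eq_norm_sq_to_K, inner_self_eq_norm_sq_to_K]
        push_cast
        rfl
  change ((⟪(x : H), y⟫_ℂ).re : ℂ) = ⟪(x : H), y⟫_ℂ ∧ 0 ≤ (⟪(x : H), y⟫_ℂ).re
  rw [key, Complex.ofReal_re]
  exact ⟨rfl, by positivity⟩

/-- `⟨A⟩ ^ (-s) = ((A² + 1)⁻¹) ^ (s / 2)` for `s > 0`, where `⟨A⟩ = √(A² + 1)`. -/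
def bracketNegPow (A : H →ₗ.[ℂ] H) (s : ℝ) : H →L[ℂ] H :=
  CFC.rpow (invSqAddOne A) (s / 2)

/-- `⟨m⟩ = √(m² + 1)`. -/
def bracket (m : ℤ) : ℝ := Real.sqrt ((m : ℝ) ^ 2 + 1)

/-! ### Commutators, regularity classes and propagation -/

/-- `C` is the bounded operator associated with the form
`(φ, ψ) ↦ ⟪A φ, B ψ⟫ - ⟪φ, B A ψ⟫` on the domain of `A`. -/
def IsCommutator (A : H →ₗ.[ℂ] H) (B C : H →L[ℂ] H) : Prop :=
  ∀ φ ψ : A.domain, ⟪A φ, B ψ⟫_ℂ - ⟪(φ : H), B (A ψ)⟫_ℂ = ⟪(φ : H), C ψ⟫_ℂ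

/-- `B ∈ C¹(A)`. -/
def IsC1 (A : H →ₗ.[ℂ] H) (B : H →L[ℂ] H) : Prop := ∃ C : H →L[ℂ] H, IsCommutator A B C

open Classical in
/-- The commutator `ad_A B = [A, B]` of `B ∈ C¹(A)` (and `0` if `B ∉ C¹(A)`). -/
def ad (A : H →ₗ.[ℂ] H) (B : H →L[ℂ] H) : H →L[ℂ] H :=
  if h : IsC1 A B then Classical.choose h else 0

/-- `B ∈ C^k(A)`: the iterated commutators `ad_A^j B`, `j < k`, are all of class `C¹(A)`. -/
def IsCk (A : H →ₗ.[ℂ] H) (k : ℕ) (B : H →L[ℂ] H) : Prop :=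
  ∀ j < k, IsC1 A ((ad A)^[j] B)

/-- `B ∈ C^∞(A)`. -/
def IsCinfty (A : H →ₗ.[ℂ] H) (B : H →L[ℂ] H) : Prop := ∀ k : ℕ, IsCk A k B

/-- `U` is propagating with respect to `A` on `Θ`: `U ∈ C¹(A)` and
`E_Θ (U* A U - A) E_Θ ≥ c E_Θ + K` for some `c > 0` and some compact operator `K`, where
`U* A U - A` stands for the bounded operator `U* (ad_A U)`. -/
def IsPropagating (A : H →ₗ.[ℂ] H) (U : unitary (H →L[ℂ] H)) (Θ : Set Circle) : Prop :=
  IsC1 A (U : H →L[ℂ] H) ∧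
  ∃ c : ℝ, 0 < c ∧ ∃ K : H →L[ℂ] H, IsCompactOperator K ∧
    (c : ℂ) • spectralProj U Θ + K ≤
      spectralProj U Θ * (star (U : H →L[ℂ] H) * ad A (U : H →L[ℂ] H)) * spectralProj U Θ

/-- `Φ` is a smooth function on the circle whose (compact) support lies in `S`. -/
def IsSmoothWithSupportIn (Φ : C(Circle, ℂ)) (S : Set Circle) : Prop :=
  ContDiff ℝ ∞ (fun θ : ℝ => Φ (Circle.exp θ)) ∧ tsupport Φ ⊆ S

end UnitaryMourre

end

/-!
Since `U ∈ C^∞(A)`, the conjugate `e^{-εA} U e^{εA}` makes sense as a formal power series in `ε`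
with bounded coefficients, whose first order term is governed by the Mourre estimate. Near a point
of `Θ \ σ_pp(U)` the compact error in that estimate becomes small on short spectral arcs, so the
Taylor polynomial of `U χ(U)`, for a cutoff `χ` to such an arc, has norm at most `e^{-κε}` for
small `ε ≥ 0`, and its `m`-th power has norm at most `e^{-κεm}`. The Taylor polynomials in `ε` of
`e^{±εA} ⟨A⟩^{-2n}` undo the conjugation up to an error of order `ε^{2n-1}`, so that integrating
from `ε₀` down to `0` gives the decay `m^{-2n}` between the weights `⟨A⟩^{-2n}`. The inequality
`‖b T b‖² ≤ ‖T‖ ‖b² T b²‖` interpolates down to all `0 < s' < s`, a partition of unity glues the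
local estimates, and adjoints give the negative powers.
-/

noncomputable section

namespace UnitaryMourre

section Commutator

variable {H : Type*} [NormedAddCommGroup H] [InnerProductSpace ℂ H] {A : H →ₗ.[ℂ] H}
  {B B' C C' : H →L[ℂ] H}

theorem IsCommutator.inner_sub_inner (h : IsCommutator A B C) {x x' y y' : H}
    (hx : (x, x') ∈ A.graph) (hy : (y, y') ∈ A.graph) :
    ⟪x', B y⟫_ℂ - ⟪x, B y'⟫_ℂ = ⟪x, C y⟫_ℂ := by
  obtain ⟨φ, rfl, rfl⟩ := A.mem_graph_iff.mp hx
  obtain ⟨ψ, rfl, rfl⟩ := A.mem_graph_iff.mp hy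
  exact h φ ψ

/-- The pairs `(B, ad_A B)` with `B ∈ C¹(A)`, as a subspace: the graph of `ad_A`. -/
def adGraph (A : H →ₗ.[ℂ] H) : Submodule ℂ ((H →L[ℂ] H) × (H →L[ℂ] H)) where
  carrier := {p | IsCommutator A p.1 p.2}
  zero_mem' := fun φ ψ => by simp
  add_mem' := fun {p q} hp hq φ ψ => by
    simp only [Prod.fst_add, Prod.snd_add, add_apply, inner_add_right]
    linear_combination hp φ ψ + hq φ ψ
  smul_mem' := fun c p hp φ ψ => by
    simp only [Prod.smul_fst, Prod.smul_snd, smul_apply, inner_smul_right]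
    linear_combination c * hp φ ψ

theorem mem_adGraph : (B, C) ∈ adGraph A ↔ IsCommutator A B C := Iff.rfl

theorem isClosed_adGraph : IsClosed (adGraph A : Set ((H →L[ℂ] H) × (H →L[ℂ] H))) := by
  change IsClosed {p : (H →L[ℂ] H) × (H →L[ℂ] H) | ∀ φ ψ : A.domain,
    ⟪A φ, p.1 ψ⟫_ℂ - ⟪(φ : H), p.1 (A ψ)⟫_ℂ = ⟪(φ : H), p.2 ψ⟫_ℂ}
  simp only [Set.ofPred_forall]
  exact isClosed_iInter fun φ => isClosed_iInter fun ψ => isClosed_eq (by fun_prop) (by fun_prop)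

theorem IsCommutator.hasSum {ι : Type*} {f g : ι → H →L[ℂ] H}
    (h : ∀ i, IsCommutator A (f i) (g i)) (hf : HasSum f B) (hg : HasSum g C) :
    IsCommutator A B C :=
  mem_adGraph.mp <| isClosed_adGraph.mem_of_tendsto (hf.prodMk hg)
    (.of_forall fun _ => (adGraph A).sum_mem fun i _ => h i)

theorem isCommutator_ad (h : IsC1 A B) : IsCommutator A B (ad A B) := by
  unfold ad
  rw [dif_pos h]
  exact Classical.choose_spec h

variable [CompleteSpace H]

theorem graph_adjoint_eq_graph (hA : IsSelfAdjoint A) : A.graph.adjoint = A.graph := by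
  rw [← LinearPMap.adjoint_graph_eq_graph_adjoint hA.dense_domain,
    LinearPMap.isSelfAdjoint_def.mp hA]

theorem inner_eq_inner_of_mem_graph (hA : IsSelfAdjoint A) {x x' y y' : H}
    (hx : (x, x') ∈ A.graph) (hy : (y, y') ∈ A.graph) : ⟪x', y⟫_ℂ = ⟪x, y'⟫_ℂ := by
  rw [← graph_adjoint_eq_graph hA, Submodule.mem_adjoint_iff] at hy
  exact sub_eq_zero.mp (hy x x' hx)

theorem mem_graph_of_inner_eq (hA : IsSelfAdjoint A) {y y' : H}
    (h : ∀ x x', (x, x') ∈ A.graph → ⟪x', y⟫_ℂ = ⟪x, y'⟫_ℂ) : (y, y') ∈ A.graph := by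
  rw [← graph_adjoint_eq_graph hA, Submodule.mem_adjoint_iff]
  exact fun x x' hx => sub_eq_zero.mpr (h x x' hx)

theorem IsCommutator.mem_graph (hA : IsSelfAdjoint A) (h : IsCommutator A B C) {y y' : H}
    (hy : (y, y') ∈ A.graph) : (B y, B y' + C y) ∈ A.graph :=
  mem_graph_of_inner_eq hA fun _ _ hx => by
    rw [inner_add_right, ← h.inner_sub_inner hx hy, add_sub_cancel]

theorem isCommutator_one (hA : IsSelfAdjoint A) : IsCommutator A (1 : H →L[ℂ] H) 0 :=
  fun φ ψ => by
    simp [inner_eq_inner_of_mem_graph hA (A.mem_graph φ) (A.mem_graph ψ)]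

theorem IsCommutator.mul (hA : IsSelfAdjoint A) (h : IsCommutator A B C)
    (h' : IsCommutator A B' C') : IsCommutator A (B * B') (C * B' + B * C') := fun φ ψ => by
  have hBB' := h.inner_sub_inner (A.mem_graph φ) (h'.mem_graph hA (A.mem_graph ψ))
  simp only [mul_apply_eq_comp, add_apply, inner_add_right, map_add] at hBB' ⊢
  linear_combination hBB'

theorem IsCommutator.star (h : IsCommutator A B C) : IsCommutator A (star B) (-star C) :=
  fun φ ψ => by
    have hBC := congrArg (starRingEnd ℂ) (h ψ φ)
    simp only [map_sub, inner_conj_symm] at hBC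
    simp only [ContinuousLinearMap.star_eq_adjoint, neg_apply, inner_neg_right,
      ContinuousLinearMap.adjoint_inner_right]
    linear_combination -hBC

theorem IsCommutator.unique (hA : IsSelfAdjoint A) (h : IsCommutator A B C)
    (h' : IsCommutator A B C') : C = C' := by
  refine ContinuousLinearMap.coeFn_injective
    (C.continuous.ext_on hA.dense_domain C'.continuous fun ψ hψ => ?_)
  refine Dense.eq_of_inner_right ℂ hA.dense_domain fun φ hφ => ?_
  exact (h ⟨φ, hφ⟩ ⟨ψ, hψ⟩).symm.trans (h' ⟨φ, hφ⟩ ⟨ψ, hψ⟩)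

end Commutator

section TaylorSeries

open PowerSeries Finset

variable {H : Type*} [NormedAddCommGroup H] [InnerProductSpace ℂ H] {A : H →ₗ.[ℂ] H}
  {X Y : PowerSeries (H →L[ℂ] H)}

/-- The power series `X` is the formal Taylor series of `ε ↦ e^{-εA} B e^{εA}`, where `B` is its
constant coefficient: it is a formal solution of `X' = -ad_A X`. -/
def IsTaylorSeries (A : H →ₗ.[ℂ] H) (X : PowerSeries (H →L[ℂ] H)) : Prop :=
  ∀ n : ℕ, IsCommutator A (coeff n X) (-((n + 1 : ℂ) • coeff (n + 1) X))

theorem succ_smul_coeff_mul {𝕜 R : Type*} [CommSemiring 𝕜] [Semiring R] [Algebra 𝕜 R]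
    (X Y : PowerSeries R) (n : ℕ) :
    (n + 1 : 𝕜) • coeff (n + 1) (X * Y) = ∑ p ∈ antidiagonal n,
      (((p.1 + 1 : 𝕜) • coeff (p.1 + 1) X) * coeff p.2 Y +
        coeff p.1 X * ((p.2 + 1 : 𝕜) • coeff (p.2 + 1) Y)) := by
  have hsplit : (n + 1 : 𝕜) • coeff (n + 1) (X * Y) =
      ∑ p ∈ antidiagonal (n + 1), (p.1 : 𝕜) • (coeff p.1 X * coeff p.2 Y) +
        ∑ p ∈ antidiagonal (n + 1), (p.2 : 𝕜) • (coeff p.1 X * coeff p.2 Y) := by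
    rw [coeff_mul, smul_sum, ← sum_add_distrib]
    refine sum_congr rfl fun p hp => ?_
    rw [← add_smul, ← Nat.cast_add, mem_antidiagonal.mp hp, Nat.cast_succ]
  rw [hsplit, Nat.sum_antidiagonal_succ, Nat.sum_antidiagonal_succ', sum_add_distrib]
  simp

theorem IsCinfty.exists_isTaylorSeries {B : H →L[ℂ] H} (hB : IsCinfty A B) :
    ∃ X, IsTaylorSeries A X ∧ coeff 0 X = B ∧ coeff 1 X = -ad A B := by
  refine ⟨PowerSeries.mk fun n => ((-1 : ℂ) ^ n / (n.factorial : ℂ)) • (ad A)^[n] B,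
    fun n => ?_, by simp, by simp⟩
  convert (adGraph A).smul_mem ((-1 : ℂ) ^ n / (n.factorial : ℂ))
    (mem_adGraph.mpr (isCommutator_ad (hB (n + 1) n n.lt_succ_self))) using 1
  rw [coeff_mk, coeff_mk, Prod.smul_mk, mem_adGraph, Function.iterate_succ_apply', smul_smul,
    ← neg_smul]
  have hn : (n + 1 : ℂ) ≠ 0 := by exact_mod_cast n.succ_ne_zero
  congr! 2
  rw [Nat.factorial_succ, pow_succ]
  push_cast
  field_simp

variable [CompleteSpace H]

theorem IsTaylorSeries.one (hA : IsSelfAdjoint A) : IsTaylorSeries A 1 := by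
  rintro (_ | n)
  · simpa [coeff_one] using isCommutator_one hA
  · simpa [coeff_one] using mem_adGraph.mp (adGraph A).zero_mem

theorem IsTaylorSeries.mul (hA : IsSelfAdjoint A) (hX : IsTaylorSeries A X)
    (hY : IsTaylorSeries A Y) : IsTaylorSeries A (X * Y) := by
  intro n
  have hsum := (adGraph A).sum_mem fun p (_ : p ∈ antidiagonal n) =>
    mem_adGraph.mpr ((hX p.1).mul hA (hY p.2))
  rw [← prod_mk_sum, ← coeff_mul] at hsum
  convert mem_adGraph.mp hsum using 1
  rw [succ_smul_coeff_mul, ← sum_neg_distrib]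
  exact sum_congr rfl fun p _ => by rw [neg_add, neg_mul, mul_neg]

theorem IsTaylorSeries.pow (hA : IsSelfAdjoint A) (hX : IsTaylorSeries A X) (n : ℕ) :
    IsTaylorSeries A (X ^ n) := by
  induction n with
  | zero => simpa only [pow_zero] using IsTaylorSeries.one hA
  | succ n ih => simpa only [pow_succ] using ih.mul hA hX

/-- The Taylor series of `ε ↦ e^{-εA} B⋆ e^{εA}`, given that of `ε ↦ e^{-εA} B e^{εA}`. The signs
come from `(e^{-εA} B e^{εA})⋆ = e^{εA} B⋆ e^{-εA}`. -/
def starSeries (X : PowerSeries (H →L[ℂ] H)) : PowerSeries (H →L[ℂ] H) :=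
  PowerSeries.mk fun n => (-1 : ℂ) ^ n • star (coeff n X)

theorem IsTaylorSeries.star (hX : IsTaylorSeries A X) : IsTaylorSeries A (starSeries X) := by
  intro n
  convert mem_adGraph.mp ((adGraph A).smul_mem ((-1 : ℂ) ^ n) (mem_adGraph.mpr (hX n).star))
    using 1
  · simp [starSeries]
  · simp [starSeries, pow_succ, smul_smul, mul_comm]

end TaylorSeries

section CoefficientGrowth

open PowerSeries Finset

theorem le_add_mul_pow_of_le_add {a : ℕ → ℝ} {K : ℝ} (k : ℕ)
    (h : ∀ n : ℕ, a (n + 1) ≤ a n + K * (n + 1 : ℝ) ^ k) (hK : 0 ≤ K) (n : ℕ) :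
    a n ≤ a 0 + K * (n : ℝ) ^ (k + 1) := by
  induction n with
  | zero => simp
  | succ n ih =>
    have hpow : (n : ℝ) ^ (k + 1) + (n + 1 : ℝ) ^ k ≤ (n + 1 : ℝ) ^ (k + 1) := by
      have : (n : ℝ) ^ k ≤ (n + 1 : ℝ) ^ k := by gcongr; linarith
      rw [pow_succ, pow_succ]
      nlinarith [n.cast_nonneg (α := ℝ)]
    calc a (n + 1) ≤ a 0 + K * (n : ℝ) ^ (k + 1) + K * (n + 1 : ℝ) ^ k := (h n).trans (by gcongr)
      _ = a 0 + K * ((n : ℝ) ^ (k + 1) + (n + 1 : ℝ) ^ k) := by ring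
      _ ≤ a 0 + K * ((n + 1 : ℕ) : ℝ) ^ (k + 1) := by push_cast; gcongr

theorem norm_coeff_pow_succ_le {R : Type*} [SeminormedRing R] {X : PowerSeries R}
    (hX : ‖coeff 0 X‖ ≤ 1) (j n : ℕ) :
    ‖coeff j (X ^ (n + 1))‖ ≤ ‖coeff j (X ^ n)‖ +
      ∑ i ∈ range j, ‖coeff i (X ^ n)‖ * ‖coeff (j - i) X‖ := by
  rw [pow_succ, coeff_mul, Nat.sum_antidiagonal_eq_sum_range_succ
    (fun a b => coeff a (X ^ n) * coeff b X), sum_range_succ, add_comm, Nat.sub_self]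
  refine (norm_add_le _ _).trans (add_le_add ?_ (norm_sum_le_of_le _ fun i _ => norm_mul_le _ _))
  exact (norm_mul_le _ _).trans (mul_le_of_le_one_right (norm_nonneg _) hX)

theorem exists_norm_coeff_pow_le {R : Type*} [SeminormedRing R] {X : PowerSeries R}
    (hX : ‖coeff 0 X‖ ≤ 1) (j : ℕ) :
    ∃ C : ℝ, ∀ n : ℕ, ‖coeff j (X ^ n)‖ ≤ C * (n + 1 : ℝ) ^ j := by
  induction j using Nat.strong_induction_on with
  | _ j ih =>
    choose! C hC using ih
    have hC0 : ∀ i < j, 0 ≤ C i := fun i hi => by simpa using (norm_nonneg _).trans (hC i hi 0)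
    rcases j with _ | k
    · have hanti : Antitone fun n => ‖coeff 0 (X ^ n)‖ :=
        antitone_nat_of_succ_le fun n => by simpa using norm_coeff_pow_succ_le hX 0 n
      exact ⟨‖coeff 0 (X ^ 0)‖, fun n => by simpa using hanti n.zero_le⟩
    set K : ℝ := ∑ i ∈ range (k + 1), C i * ‖coeff (k + 1 - i) X‖ with hK
    have hK0 : 0 ≤ K := sum_nonneg fun i hi =>
      mul_nonneg (hC0 i (mem_range.mp hi)) (norm_nonneg _)
    have hstep (n : ℕ) : ‖coeff (k + 1) (X ^ (n + 1))‖ ≤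
        ‖coeff (k + 1) (X ^ n)‖ + K * (n + 1 : ℝ) ^ k := by
      refine (norm_coeff_pow_succ_le hX (k + 1) n).trans (add_le_add_right ?_ _)
      rw [hK, sum_mul]
      refine sum_le_sum fun i hi => ?_
      have hi := mem_range.mp hi
      calc ‖coeff i (X ^ n)‖ * ‖coeff (k + 1 - i) X‖
          ≤ C i * (n + 1 : ℝ) ^ k * ‖coeff (k + 1 - i) X‖ := by
            gcongr
            refine (hC i hi n).trans (mul_le_mul_of_nonneg_left ?_ (hC0 i hi))
            exact pow_le_pow_right₀ (by simp) (by omega)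
        _ = C i * ‖coeff (k + 1 - i) X‖ * (n + 1 : ℝ) ^ k := by ring
    refine ⟨‖coeff (k + 1) (X ^ 0)‖ + K, fun n => ?_⟩
    have hn : (1 : ℝ) ≤ (n + 1 : ℝ) ^ (k + 1) := one_le_pow₀ (by simp)
    calc ‖coeff (k + 1) (X ^ n)‖
        ≤ ‖coeff (k + 1) (X ^ 0)‖ + K * (n : ℝ) ^ (k + 1) :=
          le_add_mul_pow_of_le_add (a := fun n => ‖coeff (k + 1) (X ^ n)‖) k hstep hK0 n
      _ ≤ ‖coeff (k + 1) (X ^ 0)‖ * (n + 1 : ℝ) ^ (k + 1) + K * (n + 1 : ℝ) ^ (k + 1) := by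
          gcongr
          · exact le_mul_of_one_le_right (norm_nonneg _) hn
          · linarith
      _ = _ := by ring

end CoefficientGrowth

section Weights

variable {H : Type*} [NormedAddCommGroup H] [InnerProductSpace ℂ H] {A : H →ₗ.[ℂ] H}

/-- The product `A B` is the bounded operator `C`: the range of `B` lies in the domain of `A`, and
`A (B y) = C y` for every `y`. -/
def IsBoundedComp (A : H →ₗ.[ℂ] H) (B C : H →L[ℂ] H) : Prop :=
  ∀ y, (B y, C y) ∈ A.graph

theorem IsBoundedComp.mul_right {B C : H →L[ℂ] H} (h : IsBoundedComp A B C) (D : H →L[ℂ] H) :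
    IsBoundedComp A (B * D) (C * D) :=
  fun y => h (D y)

theorem IsBoundedComp.smul {B C : H →L[ℂ] H} (h : IsBoundedComp A B C) (c : ℂ) :
    IsBoundedComp A (c • B) (c • C) :=
  fun y => A.graph.smul_mem c (h y)

variable [CompleteSpace H]

theorem norm_le_norm_add_of_mem_graph (hA : IsSelfAdjoint A) {x x' x'' : H}
    (h : (x, x') ∈ A.graph) (h' : (x', x'') ∈ A.graph) : ‖x'‖ ≤ ‖x'' + x‖ := by
  have hre : RCLike.re ⟪x'', x⟫_ℂ = ‖x'‖ ^ 2 := by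
    rw [inner_eq_inner_of_mem_graph hA h' h, inner_self_eq_norm_sq]
  have hsq := norm_add_sq (𝕜 := ℂ) x'' x
  rw [hre] at hsq
  exact le_of_sq_le_sq (by nlinarith [sq_nonneg ‖x''‖, sq_nonneg ‖x‖, sq_nonneg ‖x'‖])
    (norm_nonneg _)

theorem exists_isBoundedComp_invSqAddOne (hA : IsSelfAdjoint A) :
    ∃ C, IsBoundedComp A (invSqAddOne A) C ∧ IsBoundedComp A C (1 - invSqAddOne A) := by
  choose hR hAR hinv using (invSqAddOne_spec hA).1
  let L : H →ₗ[ℂ] H := A.toFun.comp ((invSqAddOne A : H →ₗ[ℂ] H).codRestrict A.domain hR)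
  have hRL (y : H) : (invSqAddOne A y, L y) ∈ A.graph := A.mem_graph ⟨_, hR y⟩
  have hLR (y : H) : (L y, y - invSqAddOne A y) ∈ A.graph := by
    rw [← eq_sub_of_add_eq (hinv y)]
    exact A.mem_graph ⟨_, hAR y⟩
  refine ⟨L.mkContinuous 1 fun y => ?_, hRL, hLR⟩
  simpa using norm_le_norm_add_of_mem_graph hA (hRL y) (hLR y)

theorem exists_isBoundedComp_invSqAddOne_pow (hA : IsSelfAdjoint A) (n : ℕ) :
    ∃ b : ℕ → H →L[ℂ] H, b 0 = invSqAddOne A ^ n ∧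
      ∀ i < 2 * n, IsBoundedComp A (b i) (b (i + 1)) := by
  obtain ⟨C, hRC, hCR⟩ := exists_isBoundedComp_invSqAddOne hA
  set R := invSqAddOne A
  have hcomm : Commute R (1 - R) := (Commute.one_right R).sub_right (Commute.refl R)
  -- `A^{2q} R^n = R^{n-q} (1 - R)^q` because `A² R = 1 - R`
  let b : ℕ → H →L[ℂ] H := fun i => if Even i then R ^ (n - i / 2) * (1 - R) ^ (i / 2)
    else C * (R ^ (n - i / 2 - 1) * (1 - R) ^ (i / 2))
  have hb_even (q : ℕ) : b (2 * q) = R ^ (n - q) * (1 - R) ^ q := by simp [b]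
  have hb_odd (q : ℕ) : b (2 * q + 1) = C * (R ^ (n - q - 1) * (1 - R) ^ q) := by
    simp [b, show (2 * q + 1) / 2 = q by omega]
  refine ⟨b, by simp [b], fun i hi => ?_⟩
  rcases Nat.even_or_odd' i with ⟨q, rfl | rfl⟩
  · have hsplit : R ^ (n - q) * (1 - R) ^ q = R * (R ^ (n - q - 1) * (1 - R) ^ q) := by
      rw [← mul_assoc, ← pow_succ', show n - q - 1 + 1 = n - q by omega]
    rw [hb_odd, hb_even, hsplit]
    exact hRC.mul_right _
  · have hsplit : R ^ (n - (q + 1)) * (1 - R) ^ (q + 1) =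
        (1 - R) * (R ^ (n - q - 1) * (1 - R) ^ q) := by
      rw [pow_succ', ← mul_assoc, ← mul_assoc, (hcomm.pow_left _).eq, Nat.sub_sub]
    rw [hb_odd, show 2 * q + 1 + 1 = 2 * (q + 1) by ring, hb_even, hsplit]
    exact hCR.mul_right _

theorem exists_powerSeries_weight (hA : IsSelfAdjoint A) (n : ℕ) :
    ∃ W : PowerSeries (H →L[ℂ] H), PowerSeries.coeff 0 W = invSqAddOne A ^ n ∧ ∀ i < 2 * n,
      IsBoundedComp A (PowerSeries.coeff i W) ((i + 1 : ℂ) • PowerSeries.coeff (i + 1) W) := by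
  obtain ⟨b, hb0, hb⟩ := exists_isBoundedComp_invSqAddOne_pow hA n
  refine ⟨PowerSeries.mk fun i => (i.factorial : ℂ)⁻¹ • b i, by simp [hb0], fun i hi => ?_⟩
  have hi1 : (i + 1 : ℂ) ≠ 0 := by exact_mod_cast i.succ_ne_zero
  convert (hb i hi).smul (i.factorial : ℂ)⁻¹ using 1
  · exact PowerSeries.coeff_mk _ _
  · rw [PowerSeries.coeff_mk, smul_smul, Nat.factorial_succ, Nat.cast_mul, mul_inv, ← mul_assoc,
      Nat.cast_succ, mul_inv_cancel₀ hi1, one_mul]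

end Weights

section ExponentialDecay

open Real

theorem pow_mul_exp_neg_le {κ t : ℝ} (hκ : 0 < κ) (ht : 0 ≤ t) (q : ℕ) :
    t ^ q * exp (-(κ * t)) ≤ q.factorial / κ ^ q := by
  have hexp := pow_div_factorial_le_exp (κ * t) (by positivity) q
  rw [div_le_iff₀ (by positivity), mul_pow] at hexp
  rw [exp_neg, ← div_eq_mul_inv, div_le_div_iff₀ (exp_pos _) (by positivity)]
  linarith

variable {E : Type*} [NormedAddCommGroup E] [NormedSpace ℝ E]

theorem norm_le_of_norm_deriv_le_exp {f f' : ℝ → E} {a G κ : ℝ} (hκ : 0 < κ) (ha : 0 ≤ a)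
    (hf : ∀ t ∈ Set.Icc 0 a, HasDerivAt f (f' t) t)
    (hf' : ∀ t ∈ Set.Icc 0 a, ‖f' t‖ ≤ G * exp (-(κ * t))) :
    ‖f 0‖ ≤ ‖f a‖ + G / κ := by
  have hG : 0 ≤ G := by simpa using (norm_nonneg _).trans (hf' 0 (Set.left_mem_Icc.mpr ha))
  have hB (t : ℝ) : HasDerivAt (fun t => G / κ * (1 - exp (-(κ * t)))) (G * exp (-(κ * t))) t := by
    have hlin : HasDerivAt (fun t => -(κ * t)) (-κ) t := by
      simpa using ((hasDerivAt_id t).const_mul κ).fun_neg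
    refine ((hlin.exp.const_sub 1).const_mul (G / κ)).congr_deriv ?_
    field_simp
  have hsub (t : ℝ) (ht : t ∈ Set.Icc 0 a) : HasDerivAt (fun t => f t - f 0) (f' t) t :=
    (hf t ht).sub_const _
  have hdist : ‖f a - f 0‖ ≤ G / κ * (1 - exp (-(κ * a))) :=
    image_norm_le_of_norm_deriv_right_le_deriv_boundary
      (fun t ht => (hsub t ht).continuousAt.continuousWithinAt)
      (fun t ht => (hsub t (Set.Ico_subset_Icc_self ht)).hasDerivWithinAt)
      (by simp) hB (fun t ht => hf' t (Set.Ico_subset_Icc_self ht)) (Set.right_mem_Icc.mpr ha)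
  calc ‖f 0‖ ≤ ‖f a‖ + ‖f a - f 0‖ := norm_le_norm_add_norm_sub _ _
    _ ≤ ‖f a‖ + G / κ := by
      gcongr
      exact hdist.trans (mul_le_of_le_one_right (by positivity) (by linarith [exp_pos (-(κ * a))]))

theorem exists_norm_le_div_pow_of_deriv {M c a : ℝ} (hM : 0 ≤ M) (hc : 0 < c) (ha : 0 < a) (p : ℕ) :
    ∃ D : ℝ, ∀ (f : ℝ → E) (k : ℝ), 0 < k →
      (∀ t ∈ Set.Icc 0 a, ∃ f', HasDerivAt f f' t ∧
        ‖f'‖ ≤ M * (t ^ p + k * t ^ (p + 1)) * exp (-(c * k * t))) →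
      ‖f a‖ ≤ M * exp (-(c * k * a)) → ‖f 0‖ ≤ D / k ^ (p + 1) := by
  refine ⟨M * ((p + 1).factorial / a ^ (p + 1) + p.factorial + 2 / c * (p + 1).factorial) *
    (2 / c) ^ (p + 1), fun f k hk hf hfa => ?_⟩
  choose! f' hf' hf'_le using hf
  set κ := c * k / 2 with hκ
  have hκ0 : 0 < κ := by positivity
  have hk_eq : k = 2 / c * κ := by rw [hκ]; field_simp
  have hexp (t : ℝ) : exp (-(c * k * t)) = exp (-(κ * t)) * exp (-(κ * t)) := by
    rw [← exp_add, hκ]; ring_nf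
  set G := M * (p.factorial / κ ^ p + 2 / c * κ * ((p + 1).factorial / κ ^ (p + 1))) with hG
  have hderiv (t : ℝ) (ht : t ∈ Set.Icc 0 a) : ‖f' t‖ ≤ G * exp (-(κ * t)) := by
    calc ‖f' t‖ ≤ M * (t ^ p + k * t ^ (p + 1)) * exp (-(c * k * t)) := hf'_le t ht
      _ = M * (t ^ p * exp (-(κ * t)) + 2 / c * κ * (t ^ (p + 1) * exp (-(κ * t)))) *
          exp (-(κ * t)) := by rw [hexp, ← hk_eq]; ring
      _ ≤ G * exp (-(κ * t)) := by
        rw [hG]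
        gcongr <;> exact pow_mul_exp_neg_le hκ0 ht.1 _
  have hend : ‖f a‖ ≤ M * ((p + 1).factorial / κ ^ (p + 1) / a ^ (p + 1)) := by
    refine hfa.trans (mul_le_mul_of_nonneg_left ?_ hM)
    rw [le_div_iff₀' (by positivity), hexp, ← mul_assoc]
    refine (mul_le_of_le_one_right (by positivity) ?_).trans (pow_mul_exp_neg_le hκ0 ha.le _)
    exact exp_le_one_iff.mpr (by nlinarith)
  calc ‖f 0‖ ≤ ‖f a‖ + G / κ := norm_le_of_norm_deriv_le_exp hκ0 ha.le hf' hderiv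
    _ ≤ M * ((p + 1).factorial / κ ^ (p + 1) / a ^ (p + 1)) + G / κ := by gcongr
    _ = _ := by
      rw [hG, hk_eq, mul_pow (2 / c) κ, pow_succ κ]
      field_simp
      ring

end ExponentialDecay

section TruncatedSeries

open PowerSeries Finset

variable {R : Type*} [NormedRing R] [NormedAlgebra ℂ R]

/-- The sum of the terms of order at most `N` of the power series `X`, evaluated at `ε`. -/
def truncEval (N : ℕ) (X : PowerSeries R) (ε : ℝ) : R :=
  ∑ j ∈ range (N + 1), (ε : ℂ) ^ j • coeff j X

/-- The truncation at order `N`, evaluated at `ε`, of the formal derivative of `X`. It exceeds the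
derivative of `truncEval N X` by `truncError N X`. -/
def truncEvalDeriv (N : ℕ) (X : PowerSeries R) (ε : ℝ) : R :=
  ∑ j ∈ range (N + 1), (ε : ℂ) ^ j • (j + 1 : ℂ) • coeff (j + 1) X

/-- The term of order `N` of the formal derivative of `X`, evaluated at `ε`. -/
def truncError (N : ℕ) (X : PowerSeries R) (ε : ℝ) : R :=
  (ε : ℂ) ^ N • (N + 1 : ℂ) • coeff (N + 1) X

theorem truncEval_zero (N : ℕ) (X : PowerSeries R) : truncEval N X 0 = coeff 0 X := by
  simp [truncEval, sum_range_succ']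

theorem hasDerivAt_truncEval (N : ℕ) (X : PowerSeries R) (ε : ℝ) :
    HasDerivAt (truncEval N X) (truncEvalDeriv N X ε - truncError N X ε) ε := by
  have hpow (j : ℕ) : HasDerivAt (fun ε : ℝ => (ε : ℂ) ^ j) (j * (ε : ℂ) ^ (j - 1)) ε := by
    simpa using (hasDerivAt_pow j (ε : ℂ)).comp_ofReal
  refine (HasDerivAt.fun_sum fun j _ => (hpow j).smul_const (coeff j X)).congr_deriv ?_
  rw [truncEvalDeriv, truncError, sum_range_succ (fun j => (ε : ℂ) ^ j • (j + 1 : ℂ) • _),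
    add_sub_cancel_right, sum_range_succ']
  simp [smul_smul, mul_comm]

theorem exists_norm_truncEval_le_of_mem_Icc (N : ℕ) (X : PowerSeries R) (a b : ℝ) :
    ∃ M : ℝ, 0 ≤ M ∧ ∀ ε ∈ Set.Icc a b, ‖truncEval N X ε‖ ≤ M := by
  obtain ⟨M, hM⟩ := (isCompact_Icc (a := a) (b := b)).exists_bound_of_continuousOn
    fun ε _ => (hasDerivAt_truncEval N X ε).continuousAt.continuousWithinAt
  exact ⟨max M 0, le_max_right _ _, fun ε hε => (hM ε hε).trans (le_max_left _ _)⟩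

theorem norm_truncError (N : ℕ) (X : PowerSeries R) (ε : ℝ) :
    ‖truncError N X ε‖ = (N + 1) * ‖coeff (N + 1) X‖ * |ε| ^ N := by
  have : ‖(N + 1 : ℂ)‖ = N + 1 := by exact_mod_cast Complex.norm_natCast (N + 1)
  rw [truncError, norm_smul, norm_smul, this, norm_pow, Complex.norm_real, Real.norm_eq_abs]
  ring

end TruncatedSeries

section ApproximateFlow

open PowerSeries Finset

variable {H : Type*} [NormedAddCommGroup H] [InnerProductSpace ℂ H] {A : H →ₗ.[ℂ] H}

/-- At `ε`, the curve `Q` has derivative `Q'` and solves the equation `Q' = -ad_A Q` of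
`ε ↦ e^{-εA} B e^{εA}` up to the error `ρ`. -/
def IsApproxFlow (A : H →ₗ.[ℂ] H) (Q : ℝ → H →L[ℂ] H) (Q' ρ : H →L[ℂ] H) (ε : ℝ) : Prop :=
  HasDerivAt Q Q' ε ∧ IsCommutator A (Q ε) (-(Q' + ρ))

theorem IsTaylorSeries.isApproxFlow_truncEval {X : PowerSeries (H →L[ℂ] H)}
    (hX : IsTaylorSeries A X) (N : ℕ) (ε : ℝ) :
    IsApproxFlow A (truncEval N X) (truncEvalDeriv N X ε - truncError N X ε)
      (truncError N X ε) ε := by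
  refine ⟨hasDerivAt_truncEval N X ε, ?_⟩
  have hterm (j : ℕ) : ((ε : ℂ) ^ j • coeff j X, (ε : ℂ) ^ j • -((j + 1 : ℂ) • coeff (j + 1) X)) ∈
      adGraph A :=
    (adGraph A).smul_mem ((ε : ℂ) ^ j) (mem_adGraph.mpr (hX j))
  have hsum := (adGraph A).sum_mem fun j (_ : j ∈ range (N + 1)) => hterm j
  rw [← prod_mk_sum, mem_adGraph] at hsum
  simpa only [sub_add_cancel, truncEval, truncEvalDeriv, smul_neg, sum_neg_distrib] using hsum

theorem isBoundedComp_truncEval {W : PowerSeries (H →L[ℂ] H)} {N : ℕ}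
    (hW : ∀ i ≤ N, IsBoundedComp A (coeff i W) ((i + 1 : ℂ) • coeff (i + 1) W)) (ε : ℝ) :
    IsBoundedComp A (truncEval N W ε) (truncEvalDeriv N W ε) := fun y => by
  have hsum := A.graph.sum_mem fun i (hi : i ∈ range (N + 1)) =>
    A.graph.smul_mem ((ε : ℂ) ^ i) (hW i (mem_range_succ_iff.mp hi) y)
  simp only [Prod.smul_mk, ← prod_mk_sum] at hsum
  simpa only [truncEval, truncEvalDeriv, _root_.sum_apply, smul_apply] using hsum

theorem norm_pow_le_of_norm_le {B : H →L[ℂ] H} {r : ℝ} (hB : ‖B‖ ≤ r) (m : ℕ) :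
    ‖B ^ m‖ ≤ r ^ m := by
  rcases m.eq_zero_or_pos with rfl | hm
  · rw [pow_zero, pow_zero]
    exact ContinuousLinearMap.norm_id_le
  · exact (norm_pow_le' B hm).trans (by gcongr)

variable [CompleteSpace H]

theorem IsApproxFlow.mul (hA : IsSelfAdjoint A) {Q₁ Q₂ : ℝ → H →L[ℂ] H}
    {Q₁' Q₂' ρ₁ ρ₂ : H →L[ℂ] H} {ε : ℝ} (h₁ : IsApproxFlow A Q₁ Q₁' ρ₁ ε)
    (h₂ : IsApproxFlow A Q₂ Q₂' ρ₂ ε) :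
    IsApproxFlow A (fun ε => Q₁ ε * Q₂ ε) (Q₁' * Q₂ ε + Q₁ ε * Q₂')
      (ρ₁ * Q₂ ε + Q₁ ε * ρ₂) ε := by
  refine ⟨h₁.1.mul h₂.1, ?_⟩
  convert h₁.2.mul hA h₂.2 using 1
  noncomm_ring

theorem IsApproxFlow.pow (hA : IsSelfAdjoint A) {Q : ℝ → H →L[ℂ] H} {Q' ρ : H →L[ℂ] H} {ε r : ℝ}
    (h : IsApproxFlow A Q Q' ρ ε) (hr : ‖Q ε‖ ≤ r) (m : ℕ) :
    ∃ Q'' ρ', IsApproxFlow A (fun ε => Q ε ^ m) Q'' ρ' ε ∧ ‖ρ'‖ * r ≤ m * r ^ m * ‖ρ‖ := by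
  have hr0 : 0 ≤ r := (norm_nonneg _).trans hr
  induction m with
  | zero =>
    refine ⟨0, 0, ⟨?_, ?_⟩, by simp⟩
    · simpa using hasDerivAt_const ε (1 : H →L[ℂ] H)
    · simpa using isCommutator_one hA
  | succ m ih =>
    obtain ⟨Q'', ρ', hflow, hρ'⟩ := ih
    refine ⟨_, _, by simpa only [pow_succ] using hflow.mul hA h, ?_⟩
    calc ‖ρ' * Q ε + Q ε ^ m * ρ‖ * r
        ≤ (‖ρ'‖ * ‖Q ε‖ + ‖Q ε ^ m‖ * ‖ρ‖) * r := by
          gcongr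
          exact (norm_add_le _ _).trans (add_le_add (norm_mul_le _ _) (norm_mul_le _ _))
      _ ≤ (‖ρ'‖ * r + r ^ m * ‖ρ‖) * r := by gcongr; exact norm_pow_le_of_norm_le hr m
      _ ≤ (m * r ^ m * ‖ρ‖ + r ^ m * ‖ρ‖) * r := by gcongr
      _ = ((m + 1 : ℕ) : ℝ) * r ^ (m + 1) * ‖ρ‖ := by push_cast; ring

theorem IsBoundedComp.star_mul_sub_mul {P P₁ N N₁ B C : H →L[ℂ] H} (hP : IsBoundedComp A P P₁)
    (hN : IsBoundedComp A N N₁) (hB : IsCommutator A B C) :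
    star P₁ * B * N - star P * B * N₁ = star P * C * N := by
  refine ContinuousLinearMap.ext fun y => ext_inner_left ℂ fun x => ?_
  simpa only [ContinuousLinearMap.star_eq_adjoint, sub_apply, mul_apply_eq_comp, inner_sub_right,
    ContinuousLinearMap.adjoint_inner_right] using hB.inner_sub_inner (hP x) (hN y)

-- `ε ↦ (e^{εA} B)⋆ (e^{-εA} Q e^{εA}) (e^{-εA} B)` is constant, so only the errors contribute.
theorem IsApproxFlow.hasDerivAt_star_mul_mul {P N Q : ℝ → H →L[ℂ] H}
    {P' N' Q' ρ₁ ρ₂ ρ : H →L[ℂ] H} {ε : ℝ} (hQ : IsApproxFlow A Q Q' ρ ε)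
    (hP : HasDerivAt P P' ε) (hAP : IsBoundedComp A (P ε) (P' + ρ₁))
    (hN : HasDerivAt N N' ε) (hAN : IsBoundedComp A (N ε) (-(N' + ρ₂))) :
    HasDerivAt (fun ε => star (P ε) * Q ε * N ε)
      (-(star ρ₁ * Q ε * N ε + star (P ε) * ρ * N ε + star (P ε) * Q ε * ρ₂)) ε := by
  refine ((hP.star.fun_mul hQ.1).fun_mul hN).congr_deriv ?_
  have hcomm := hAP.star_mul_sub_mul hAN hQ.2
  rw [star_add] at hcomm
  rw [← sub_eq_zero] at hcomm ⊢
  rw [← hcomm]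
  noncomm_ring

end ApproximateFlow

section PowerDecay

open PowerSeries Real

variable {H : Type*} [NormedAddCommGroup H] [InnerProductSpace ℂ H] [CompleteSpace H]
  {A : H →ₗ.[ℂ] H} {X Y W : PowerSeries (H →L[ℂ] H)}

theorem IsApproxFlow.pow_mul (hA : IsSelfAdjoint A) {V Q : ℝ → H →L[ℂ] H}
    {V' Q' ρ₁ ρ₂ : H →L[ℂ] H} {ε r g : ℝ} (hV : IsApproxFlow A V V' ρ₁ ε)
    (hQ : IsApproxFlow A Q Q' ρ₂ ε) (hr : ‖V ε‖ ≤ r) (hgr : 1 ≤ g * r) (m : ℕ) :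
    ∃ F' ρ, IsApproxFlow A (fun ε => V ε ^ m * Q ε) F' ρ ε ∧
      ‖ρ‖ ≤ g * (g * ‖ρ₁‖ * ‖Q ε‖ + ‖ρ₂‖) * ((m + 1) * r ^ (m + 1)) := by
  obtain ⟨V'', ρ, hflow, hρ⟩ := hV.pow hA hr m
  have hr0 : 0 ≤ r := (norm_nonneg _).trans hr
  have hg0 : 0 < g := pos_of_mul_pos_left (one_pos.trans_le hgr) hr0
  have hρ_le : ‖ρ‖ ≤ m * r ^ m * ‖ρ₁‖ * g := calc
    ‖ρ‖ ≤ ‖ρ‖ * (g * r) := le_mul_of_one_le_right (norm_nonneg _) hgr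
    _ = ‖ρ‖ * r * g := by ring
    _ ≤ m * r ^ m * ‖ρ₁‖ * g := by gcongr
  refine ⟨_, _, hflow.mul hA hQ, ?_⟩
  calc ‖ρ * Q ε + V ε ^ m * ρ₂‖ ≤ ‖ρ‖ * ‖Q ε‖ + ‖V ε ^ m‖ * ‖ρ₂‖ :=
        (norm_add_le _ _).trans (add_le_add (norm_mul_le _ _) (norm_mul_le _ _))
    _ ≤ m * r ^ m * ‖ρ₁‖ * g * ‖Q ε‖ + r ^ m * ‖ρ₂‖ := by
      gcongr
      exact norm_pow_le_of_norm_le hr m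
    _ = r ^ m * (m * (g * ‖ρ₁‖ * ‖Q ε‖) + 1 * ‖ρ₂‖) := by ring
    _ ≤ g * r ^ (m + 1) * ((m + 1) * (g * ‖ρ₁‖ * ‖Q ε‖) + (m + 1) * ‖ρ₂‖) := by
      gcongr
      · rw [pow_succ']
        nlinarith [pow_nonneg hr0 m]
      · linarith
      · linarith [m.cast_nonneg (α := ℝ)]
    _ = _ := by ring

theorem exists_isApproxFlow_pow_mul (hA : IsSelfAdjoint A) (hX : IsTaylorSeries A X)
    (hY : IsTaylorSeries A Y) (N : ℕ) {c ε₀ : ℝ} (hc : 0 ≤ c)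
    (hcontr : ∀ ε ∈ Set.Icc 0 ε₀, ‖truncEval N X ε‖ ≤ exp (-(c * ε))) :
    ∃ M : ℝ, 0 ≤ M ∧ ∀ m : ℕ, ∀ ε ∈ Set.Icc 0 ε₀,
      ‖truncEval N X ε ^ m * truncEval N Y ε‖ ≤ M * exp (-(c * (m + 1) * ε)) ∧
      ∃ F' ρ, IsApproxFlow A (fun ε => truncEval N X ε ^ m * truncEval N Y ε) F' ρ ε ∧
        ‖ρ‖ ≤ M * ((m + 1) * ε ^ N) * exp (-(c * (m + 1) * ε)) := by
  obtain ⟨MY, hMY0, hMY⟩ := exists_norm_truncEval_le_of_mem_Icc N Y 0 ε₀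
  set g := exp (c * ε₀) with hg
  set eX := (N + 1) * ‖coeff (N + 1) X‖
  set eY := (N + 1) * ‖coeff (N + 1) Y‖
  have : 0 < g := exp_pos _
  have : 0 ≤ eX := by positivity
  have : 0 ≤ eY := by positivity
  refine ⟨g * (MY + (g * eX * MY + eY)), by positivity, fun m ε hε => ?_⟩
  set r := exp (-(c * ε))
  have hr0 : 0 < r := exp_pos _
  have hgr : 1 ≤ g * r := by
    rw [hg, ← exp_add]
    exact one_le_exp (by nlinarith [hε.2])
  have hrm : r ^ m ≤ g * r ^ (m + 1) := by
    rw [pow_succ']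
    nlinarith [pow_pos hr0 m]
  have hr_succ : exp (-(c * (m + 1) * ε)) = r ^ (m + 1) := by
    rw [← exp_nat_mul]
    push_cast
    ring_nf
  rw [hr_succ]
  constructor
  · calc ‖truncEval N X ε ^ m * truncEval N Y ε‖ ≤ r ^ m * MY :=
          (norm_mul_le _ _).trans (mul_le_mul (norm_pow_le_of_norm_le (hcontr ε hε) m) (hMY ε hε)
            (norm_nonneg _) (by positivity))
      _ ≤ g * r ^ (m + 1) * (MY + (g * eX * MY + eY)) := by
        gcongr
        exact le_add_of_nonneg_right (by positivity)
      _ = _ := by ring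
  · obtain ⟨F', ρ, hflow, hρ⟩ := (hX.isApproxFlow_truncEval N ε).pow_mul hA
      (hY.isApproxFlow_truncEval N ε) (hcontr ε hε) hgr m
    refine ⟨F', ρ, hflow, hρ.trans ?_⟩
    have hε0 := hε.1
    rw [norm_truncError, norm_truncError, abs_of_nonneg hε0]
    calc g * (g * (eX * ε ^ N) * ‖truncEval N Y ε‖ + eY * ε ^ N) * ((m + 1) * r ^ (m + 1))
        ≤ g * (g * (eX * ε ^ N) * MY + eY * ε ^ N) * ((m + 1) * r ^ (m + 1)) := by
          gcongr
          exact hMY ε hε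
      _ = g * (0 + (g * eX * MY + eY)) * ((m + 1) * ε ^ N) * r ^ (m + 1) := by ring
      _ ≤ _ := by gcongr

theorem hasDerivAt_star_weight_mul_mul_weight {Q : ℝ → H →L[ℂ] H} {Q' ρ : H →L[ℂ] H} {ε : ℝ}
    {p : ℕ} (hW : ∀ i ≤ p, IsBoundedComp A (coeff i W) ((i + 1 : ℂ) • coeff (i + 1) W))
    (hQ : IsApproxFlow A Q Q' ρ ε) :
    HasDerivAt (fun ε => star (truncEval p W ε) * Q ε * truncEval p W (-ε))
      (-(star (truncError p W ε) * Q ε * truncEval p W (-ε) +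
        star (truncEval p W ε) * ρ * truncEval p W (-ε) +
        star (truncEval p W ε) * Q ε * -truncError p W (-ε))) ε := by
  refine hQ.hasDerivAt_star_mul_mul (hasDerivAt_truncEval p W ε) ?_
    ((hasDerivAt_truncEval p W (-ε)).scomp ε (hasDerivAt_neg ε)) ?_
  · rw [sub_add_cancel]
    exact isBoundedComp_truncEval hW ε
  · convert isBoundedComp_truncEval hW (-ε) using 1
    rw [neg_one_smul]
    abel

theorem norm_mul₃_le_of_le {R : Type*} [NonUnitalSeminormedRing R] {a b c : R} {r s t : ℝ}
    (ha : ‖a‖ ≤ r) (hb : ‖b‖ ≤ s) (hc : ‖c‖ ≤ t) : ‖a * b * c‖ ≤ r * s * t :=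
  norm_mul_le_of_le (norm_mul_le_of_le ha hb) hc

theorem exists_norm_star_weight_mul_pow_mul_le (hA : IsSelfAdjoint A) (hX : IsTaylorSeries A X)
    (hY : IsTaylorSeries A Y) {p : ℕ}
    (hW : ∀ i ≤ p, IsBoundedComp A (coeff i W) ((i + 1 : ℂ) • coeff (i + 1) W))
    {c ε₀ : ℝ} (hc : 0 < c) (hε₀ : 0 < ε₀)
    (hcontr : ∀ ε ∈ Set.Icc 0 ε₀, ‖truncEval (p + 1) X ε‖ ≤ exp (-(c * ε))) :
    ∃ D : ℝ, ∀ m : ℕ, ‖star (coeff 0 W) * (coeff 0 X ^ m * coeff 0 Y) * coeff 0 W‖ ≤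
      D / (m + 1) ^ (p + 1) := by
  obtain ⟨M, hM0, hM⟩ := exists_isApproxFlow_pow_mul hA hX hY (p + 1) hc.le hcontr
  obtain ⟨w, hw0, hw⟩ := exists_norm_truncEval_le_of_mem_Icc p W (-ε₀) ε₀
  set e := (p + 1) * ‖coeff (p + 1) W‖
  have : 0 ≤ e := by positivity
  obtain ⟨D, hD⟩ := exists_norm_le_div_pow_of_deriv (E := H →L[ℂ] H)
    (M := M * (w * w + 2 * e * w)) (by positivity) hc hε₀ p
  refine ⟨D, fun m => ?_⟩
  set Q : ℝ → H →L[ℂ] H := fun ε => truncEval (p + 1) X ε ^ m * truncEval (p + 1) Y ε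
  have hP (ε : ℝ) (hε : ε ∈ Set.Icc 0 ε₀) : ‖star (truncEval p W ε)‖ ≤ w := by
    rw [norm_star]
    exact hw ε ⟨by linarith [hε.1], hε.2⟩
  have hN (ε : ℝ) (hε : ε ∈ Set.Icc 0 ε₀) : ‖truncEval p W (-ε)‖ ≤ w :=
    hw (-ε) ⟨neg_le_neg hε.2, by linarith [hε.1]⟩
  have hbound := hD (fun ε => star (truncEval p W ε) * Q ε * truncEval p W (-ε)) (m + 1)
    (by positivity) (fun ε hε => ?_) ?_
  · simpa only [Q, neg_zero, truncEval_zero] using hbound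
  · obtain ⟨hQ, Q', ρ, hflow, hρ⟩ := hM m ε hε
    refine ⟨_, hasDerivAt_star_weight_mul_mul_weight hW hflow, ?_⟩
    have herr : ‖star (truncError p W ε)‖ ≤ e * ε ^ p := by
      rw [norm_star, norm_truncError, abs_of_nonneg hε.1]
    have herr_neg : ‖-truncError p W (-ε)‖ ≤ e * ε ^ p := by
      rw [norm_neg, norm_truncError, abs_neg, abs_of_nonneg hε.1]
    rw [norm_neg]
    refine (norm_add₃_le.trans (add_le_add_three (norm_mul₃_le_of_le herr hQ (hN ε hε))
      (norm_mul₃_le_of_le (hP ε hε) hρ (hN ε hε))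
      (norm_mul₃_le_of_le (hP ε hε) hQ herr_neg))).trans ?_
    set x := exp (-(c * (m + 1) * ε))
    have hε0 := hε.1
    have hrest : 0 ≤ M * x * (w * w * ε ^ p + 2 * e * w * ((m + 1) * ε ^ (p + 1))) := by positivity
    linarith only [hrest]
  · refine (norm_mul₃_le_of_le (hP ε₀ ⟨hε₀.le, le_rfl⟩) (hM m ε₀ ⟨hε₀.le, le_rfl⟩).1
      (hN ε₀ ⟨hε₀.le, le_rfl⟩)).trans ?_
    have hrest : 0 ≤ M * (2 * e * w) * exp (-(c * (m + 1) * ε₀)) := by positivity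
    linarith only [hrest]

end PowerDecay

section Interpolation

theorem spectralRadius_mul_comm {𝕜 R : Type*} [NormedField 𝕜] [Ring R] [Algebra 𝕜 R] (a b : R) :
    spectralRadius 𝕜 (a * b) = spectralRadius 𝕜 (b * a) := by
  have hle (a b : R) : spectralRadius 𝕜 (a * b) ≤ spectralRadius 𝕜 (b * a) := by
    refine iSup₂_le fun k hk => ?_
    rcases eq_or_ne k 0 with rfl | hk0
    · simp
    · have hk' : k ∈ spectrum 𝕜 (b * a) \ {0} := by
        rw [← spectrum.nonzero_mul_comm]
        exact ⟨hk, hk0⟩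
      exact le_iSup₂ (f := fun (k : 𝕜) (_ : k ∈ spectrum 𝕜 (b * a)) => (‖k‖₊ : ENNReal)) k hk'.1
  exact (hle a b).antisymm (hle b a)

theorem norm_mul_mul_sq_le {𝔄 : Type*} [CStarAlgebra 𝔄] {b : 𝔄} (hb : IsSelfAdjoint b) (t : 𝔄) :
    ‖b * t * b‖ ^ 2 ≤ ‖t‖ * ‖b * b * t * (b * b)‖ := by
  rcases subsingleton_or_nontrivial 𝔄 with _ | _
  · rw [Subsingleton.elim (b * t * b) 0, norm_zero, zero_pow two_ne_zero]
    positivity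
  have hcycle : spectralRadius ℂ (star (b * t * b) * (b * t * b)) =
      spectralRadius ℂ (star t * (b * b * t * (b * b))) := by
    rw [star_mul, star_mul, hb.star_eq, mul_assoc b, spectralRadius_mul_comm]
    congr 1
    noncomm_ring
  calc ‖b * t * b‖ ^ 2 = (spectralRadius ℂ (star t * (b * b * t * (b * b)))).toReal := by
        rw [← CStarAlgebra.toReal_spectralRadius_star_mul_self_eq_norm_sq, hcycle]
    _ ≤ ‖star t * (b * b * t * (b * b))‖ :=
      ENNReal.toReal_le_coe_of_le_coe (spectrum.spectralRadius_le_nnnorm _)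
    _ ≤ ‖t‖ * ‖b * b * t * (b * b)‖ := (norm_mul_le _ _).trans_eq (by rw [norm_star])

variable {H : Type*} [NormedAddCommGroup H] [InnerProductSpace ℂ H] [CompleteSpace H]
  {A : H →ₗ.[ℂ] H} {s t q r K : ℝ}

theorem bracketNegPow_add (hs : 0 < s) (ht : 0 < t) :
    bracketNegPow A (s + t) = bracketNegPow A s * bracketNegPow A t := by
  have hnnrpow {s : ℝ} (hs : 0 < s) :
      bracketNegPow A s = invSqAddOne A ^ (Real.toNNReal (s / 2)) := by
    rw [CFC.nnrpow_eq_rpow (Real.toNNReal_pos.mpr (half_pos hs)),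
      Real.coe_toNNReal _ (half_pos hs).le]
    rfl
  rw [hnnrpow hs, hnnrpow ht, hnnrpow (add_pos hs ht), add_div,
    Real.toNNReal_add (half_pos hs).le (half_pos ht).le,
    CFC.nnrpow_add (Real.toNNReal_pos.mpr (half_pos hs)) (Real.toNNReal_pos.mpr (half_pos ht))]

theorem isSelfAdjoint_bracketNegPow (s : ℝ) : IsSelfAdjoint (bracketNegPow A s) :=
  IsSelfAdjoint.of_nonneg CFC.rpow_nonneg

theorem bracketNegPow_two_mul (hA : IsSelfAdjoint A) (n : ℕ) :
    bracketNegPow A (2 * n) = invSqAddOne A ^ n := by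
  rw [bracketNegPow, mul_div_cancel_left₀ (n : ℝ) two_ne_zero]
  exact CFC.rpow_natCast _ _ (invSqAddOne_nonneg hA)

/-- Between the weights `⟨A⟩ ^ (-s)`, the operators `T m` decay with exponent `q`. The bound is
required for every `m`, with `m + 1` in place of `m` so as to include `m = 0`. -/
def HasDecay (A : H →ₗ.[ℂ] H) (T : ℕ → H →L[ℂ] H) (s q : ℝ) : Prop :=
  (fun m => bracketNegPow A s * T m * bracketNegPow A s) =O[⊤] fun m : ℕ => (m + 1 : ℝ) ^ (-q)

variable {T : ℕ → H →L[ℂ] H}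

theorem HasDecay.sum {ι : Type*} {S : ι → ℕ → H →L[ℂ] H} {t : Finset ι}
    (h : ∀ i ∈ t, HasDecay A (S i) s q) : HasDecay A (fun m => ∑ i ∈ t, S i m) s q := by
  simp only [HasDecay, Finset.mul_sum, Finset.sum_mul]
  exact Asymptotics.IsBigO.fun_sum h

theorem HasDecay.mono_exponent (h : HasDecay A T s q) (hqr : r ≤ q) : HasDecay A T s r :=
  h.trans <| Asymptotics.isBigO_of_le _ fun m => by
    rw [Real.norm_of_nonneg (by positivity), Real.norm_of_nonneg (by positivity)]
    exact Real.rpow_le_rpow_of_exponent_le (by simp) (neg_le_neg hqr)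

theorem HasDecay.mono_weight (h : HasDecay A T s q) (hs : 0 < s) (hst : s ≤ t) :
    HasDecay A T t q := by
  rcases hst.eq_or_lt with rfl | hst
  · exact h
  set B := bracketNegPow A (t - s)
  have hleft : bracketNegPow A t = B * bracketNegPow A s := by
    rw [← bracketNegPow_add (sub_pos.mpr hst) hs, sub_add_cancel]
  have hright : bracketNegPow A t = bracketNegPow A s * B := by
    rw [← bracketNegPow_add hs (sub_pos.mpr hst), add_sub_cancel]
  have hsplit (m : ℕ) : bracketNegPow A t * T m * bracketNegPow A t =
      B * (bracketNegPow A s * T m * bracketNegPow A s) * B := by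
    nth_rewrite 1 [hleft]
    rw [hright]
    noncomm_ring
  refine Asymptotics.IsBigO.trans (Asymptotics.IsBigO.of_bound (‖B‖ * ‖B‖) ?_) h
  refine Filter.Eventually.of_forall fun m => ?_
  rw [hsplit, mul_right_comm]
  exact norm_mul_le_of_le (norm_mul_le _ _) le_rfl

theorem HasDecay.halve (hT : ∀ m, ‖T m‖ ≤ K) (hs : 0 < s) (h : HasDecay A T (2 * s) (2 * q)) :
    HasDecay A T s q := by
  refine Asymptotics.IsBigO.of_norm_left (Asymptotics.IsBigO.of_pow two_ne_zero ?_)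
  have hsq (m : ℕ) : ((m + 1 : ℝ) ^ (-q)) ^ 2 = (m + 1 : ℝ) ^ (-(2 * q)) := by
    rw [← Real.rpow_mul_natCast (by positivity)]
    push_cast
    ring_nf
  simp only [Pi.pow_def, hsq]
  refine Asymptotics.IsBigO.trans (Asymptotics.IsBigO.of_bound K (.of_forall fun m => ?_)) h
  rw [two_mul s, bracketNegPow_add hs hs, Real.norm_of_nonneg (by positivity)]
  refine (norm_mul_mul_sq_le (isSelfAdjoint_bracketNegPow s) (T m)).trans ?_
  gcongr
  exact hT m

theorem HasDecay.halve_iterate (hT : ∀ m, ‖T m‖ ≤ K) (hs : 0 < s) (i : ℕ)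
    (h : HasDecay A T (2 ^ i * s) (2 ^ i * q)) : HasDecay A T s q := by
  induction i with
  | zero => simpa using h
  | succ i ih =>
    rw [pow_succ', mul_assoc, mul_assoc] at h
    exact ih (h.halve hT (by positivity))

theorem hasDecay_of_forall_even (hT : ∀ m, ‖T m‖ ≤ K)
    (h : ∀ n : ℕ, 1 ≤ n → HasDecay A T (2 * n) (2 * n)) (hq : 0 < q) (hqs : q < s) :
    HasDecay A T s q := by
  have hs : 0 < s := hq.trans hqs
  obtain ⟨i, hi⟩ := pow_unbounded_of_one_lt (2 / (s - q)) (one_lt_two (α := ℝ))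
  rw [div_lt_iff₀ (sub_pos.mpr hqs), mul_sub] at hi
  set n := ⌊2 ^ i * s / 2⌋₊
  have hn_le : (n : ℝ) ≤ 2 ^ i * s / 2 := Nat.floor_le (by positivity)
  have hlt_n : 2 ^ i * s / 2 < n + 1 := Nat.lt_floor_add_one _
  have hq' : 0 < 2 ^ i * q := by positivity
  have hn : 1 ≤ n := Nat.le_floor (by push_cast; linarith)
  have : (0 : ℝ) < n := by exact_mod_cast hn
  have hdecay : HasDecay A T (2 ^ i * s) (2 ^ i * q) :=
    ((h n hn).mono_weight (by positivity) (by linarith)).mono_exponent (by linarith)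
  exact hdecay.halve_iterate hT hs i

end Interpolation

section ContractionDecay

open PowerSeries Real

variable {H : Type*} [NormedAddCommGroup H] [InnerProductSpace ℂ H] [CompleteSpace H]
  {A : H →ₗ.[ℂ] H} {X Y : PowerSeries (H →L[ℂ] H)}

theorem hasDecay_pow_mul_of_norm_truncEval_le (hA : IsSelfAdjoint A) (hX : IsTaylorSeries A X)
    (hY : IsTaylorSeries A Y) {n : ℕ} (hn : 1 ≤ n) {c ε₀ : ℝ} (hc : 0 < c) (hε₀ : 0 < ε₀)
    (hcontr : ∀ ε ∈ Set.Icc 0 ε₀, ‖truncEval (2 * n) X ε‖ ≤ exp (-(c * ε))) :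
    HasDecay A (fun m => coeff 0 X ^ m * coeff 0 Y) (2 * n) (2 * n) := by
  obtain ⟨W, hW0, hW⟩ := exists_powerSeries_weight hA n
  obtain ⟨p, hp⟩ : ∃ p, 2 * n = p + 1 := ⟨2 * n - 1, by omega⟩
  obtain ⟨D, hD⟩ := exists_norm_star_weight_mul_pow_mul_le hA hX hY (p := p)
    (fun i hi => hW i (by omega)) hc hε₀ (hp ▸ hcontr)
  refine Asymptotics.isBigO_top.mpr ⟨D, fun m => ?_⟩
  have hstar : star (invSqAddOne A ^ n) = invSqAddOne A ^ n :=
    ((IsSelfAdjoint.of_nonneg (invSqAddOne_nonneg hA)).pow n).star_eq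
  have hrpow : (m + 1 : ℝ) ^ (-(2 * n : ℝ)) = ((m + 1 : ℝ) ^ (p + 1))⁻¹ := by
    rw [rpow_neg (by positivity), ← hp, ← rpow_natCast]
    push_cast
    rfl
  rw [bracketNegPow_two_mul hA, hrpow, norm_of_nonneg (by positivity), ← div_eq_mul_inv]
  simpa only [hW0, hstar] using hD m

end ContractionDecay

section Fourier

theorem fourierCoeff_of_hasDerivAt {T : ℝ} [hT : Fact (0 < T)] {f f' : AddCircle T → ℂ}
    (hf : ∀ x : ℝ, HasDerivAt (fun x : ℝ => f x) (f' x) x) (hf' : Continuous f') (n : ℤ) :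
    fourierCoeff f' n = 2 * Real.pi * Complex.I * n / T * fourierCoeff f n := by
  have : (T : ℂ) ≠ 0 := by exact_mod_cast hT.out.ne'
  have hparts := intervalIntegral.integral_mul_deriv_eq_deriv_mul (a := 0) (b := T)
    (fun x _ => hasDerivAt_fourier_neg T n x) (fun x _ => hf x)
    (Continuous.intervalIntegrable (by fun_prop) _ _)
    (Continuous.intervalIntegrable (by fun_prop) _ _)
  have hperiod : ((T : ℝ) : AddCircle T) = (0 : ℝ) := by simp
  simp only [hperiod, sub_self, mul_assoc _ (fourier _ _), zero_sub,
    intervalIntegral.integral_const_mul] at hparts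
  simp only [fourierCoeff_eq_intervalIntegral _ _ 0, zero_add, smul_eq_mul, hparts,
    Complex.real_smul]
  ring

theorem exists_smooth_deriv {T : ℝ} {f : AddCircle T → ℂ}
    (hf : ContDiff ℝ ∞ fun x : ℝ => f x) : ∃ f' : AddCircle T → ℂ,
      (ContDiff ℝ ∞ fun x : ℝ => f' x) ∧ ∀ x : ℝ, HasDerivAt (fun x : ℝ => f x) (f' x) x := by
  have hperiodic : Function.Periodic (deriv fun x : ℝ => f x) T := fun x => by
    simp [← deriv_comp_add_const]
  obtain ⟨hdiff, hderiv⟩ := contDiff_infty_iff_deriv.mp hf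
  exact ⟨hperiodic.lift, hderiv, fun x => (hdiff x).hasDerivAt⟩

theorem continuous_of_contDiff {T : ℝ} {f : AddCircle T → ℂ}
    (hf : ContDiff ℝ ∞ fun x : ℝ => f x) : Continuous f :=
  isQuotientMap_quot_mk.continuous_iff.mpr hf.continuous

theorem exists_pow_mul_norm_fourierCoeff_le {T : ℝ} [hT : Fact (0 < T)] (k : ℕ) :
    ∀ {f : AddCircle T → ℂ}, (ContDiff ℝ ∞ fun x : ℝ => f x) →
      ∃ M, ∀ n : ℤ, (n.natAbs + 1 : ℝ) ^ k * ‖fourierCoeff f n‖ ≤ M := by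
  induction k with
  | zero =>
    intro f hf
    obtain ⟨M, hM⟩ := isCompact_univ.exists_bound_of_continuousOn
      (continuous_of_contDiff hf).continuousOn
    refine ⟨M, fun n => ?_⟩
    rw [pow_zero, one_mul]
    have hbound (t : AddCircle T) : ‖fourier (-n) t • f t‖ ≤ M := by
      rw [norm_smul, fourier_apply, Circle.norm_coe, one_mul]
      exact hM t trivial
    simpa [fourierCoeff] using MeasureTheory.norm_integral_le_of_norm_le_const
      (μ := AddCircle.haarAddCircle) (.of_forall hbound)
  | succ k ih =>
    intro f hf
    obtain ⟨f', hf', hderiv⟩ := exists_smooth_deriv hf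
    obtain ⟨M, hM⟩ := ih hf
    obtain ⟨M', hM'⟩ := ih hf'
    refine ⟨T / (2 * Real.pi) * M' + M, fun n => ?_⟩
    have hcoeff : ‖fourierCoeff f' n‖ = 2 * Real.pi / T * (n.natAbs * ‖fourierCoeff f n‖) := by
      rw [fourierCoeff_of_hasDerivAt hderiv (continuous_of_contDiff hf')]
      simp [abs_of_pos hT.out, abs_of_pos Real.pi_pos, Nat.cast_natAbs]
      ring
    have hT := hT.out
    calc (n.natAbs + 1 : ℝ) ^ (k + 1) * ‖fourierCoeff f n‖
        = T / (2 * Real.pi) * ((n.natAbs + 1 : ℝ) ^ k * ‖fourierCoeff f' n‖) +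
            (n.natAbs + 1 : ℝ) ^ k * ‖fourierCoeff f n‖ := by
          rw [hcoeff]
          field_simp
          ring
      _ ≤ _ := by gcongr; exacts [hM' n, hM n]

theorem summable_norm_fourierCoeff_mul_pow {T : ℝ} [Fact (0 < T)] {f : AddCircle T → ℂ}
    (hf : ContDiff ℝ ∞ fun x : ℝ => f x) (j : ℕ) :
    Summable fun n : ℤ => ‖fourierCoeff f n‖ * (n.natAbs + 1 : ℝ) ^ j := by
  obtain ⟨M, hM⟩ := exists_pow_mul_norm_fourierCoeff_le (j + 2) hf
  have hnat : Summable fun n : ℕ => 1 / (n + 1 : ℝ) ^ 2 := by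
    exact_mod_cast (summable_nat_add_iff 1).mpr (Real.summable_one_div_nat_pow.mpr one_lt_two)
  have hint : Summable fun n : ℤ => 1 / (n.natAbs + 1 : ℝ) ^ 2 :=
    Summable.of_nat_of_neg (by simpa using hnat) (by simpa using hnat)
  refine Summable.of_nonneg_of_le (fun n => by positivity) (fun n => ?_) (hint.mul_left M)
  rw [mul_one_div, le_div_iff₀ (by positivity)]
  exact le_of_eq_of_le (by ring) (hM n)

/-- A continuous function on the circle is smooth if it is so as a function of the angle. -/
def IsSmooth (Φ : C(Circle, ℂ)) : Prop :=
  ContDiff ℝ ∞ fun θ : ℝ => Φ (Circle.exp θ)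

/-- The monomial `z ↦ z ^ n` on the circle. -/
def circleZPow (n : ℤ) : C(Circle, ℂ) where
  toFun z := (z ^ n : Circle)
  continuous_toFun := continuous_subtype_val.comp (continuous_zpow n)

theorem norm_circleZPow_le_one (n : ℤ) : ‖circleZPow n‖ ≤ 1 :=
  (ContinuousMap.norm_le _ zero_le_one).mpr fun _ => (Circle.norm_coe _).le

theorem IsSmooth.exists_hasSum_circleZPow {Φ : C(Circle, ℂ)} (hΦ : IsSmooth Φ) :
    ∃ c : ℤ → ℂ, (∀ j : ℕ, Summable fun n => ‖c n‖ * (n.natAbs + 1 : ℝ) ^ j) ∧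
      HasSum (fun n => c n • circleZPow n) Φ := by
  let f : C(UnitAddCircle, ℂ) := Φ.comp ⟨AddCircle.toCircle, AddCircle.continuous_toCircle⟩
  have hf : ContDiff ℝ ∞ fun x : ℝ => f x := by
    have : (fun x : ℝ => f x) = fun x : ℝ => Φ (Circle.exp (2 * Real.pi / 1 * x)) := by
      ext x
      simp [f, AddCircle.toCircle_apply_mk]
    rw [this]
    exact hΦ.comp (contDiff_const.mul contDiff_id)
  have hsummable := summable_norm_fourierCoeff_mul_pow hf
  have hnorm : Summable fun n => ‖fourierCoeff f n‖ := by simpa using hsummable 0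
  refine ⟨fourierCoeff f, hsummable, ?_⟩
  have hseries : Summable fun n => fourierCoeff f n • circleZPow n :=
    .of_norm_bounded hnorm fun n => (norm_smul_le _ _).trans
      (mul_le_of_le_one_right (norm_nonneg _) (norm_circleZPow_le_one n))
  convert hseries.hasSum
  ext z
  obtain ⟨x, rfl⟩ := (AddCircle.homeomorphCircle one_ne_zero).surjective z
  have hpointwise := (ContinuousMap.evalCLM ℂ x.toCircle).hasSum hseries.hasSum
  rw [AddCircle.homeomorphCircle_apply]
  refine (has_pointwise_sum_fourier_series_of_summable (f := f) hnorm.of_norm x).unique ?_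
  simpa [circleZPow, fourier_apply, AddCircle.toCircle_zsmul] using hpointwise

end Fourier

section SmoothFunctionalCalculus

open PowerSeries

variable {H : Type*} [NormedAddCommGroup H] [InnerProductSpace ℂ H] {A : H →ₗ.[ℂ] H}

theorem IsTaylorSeries.tsum {ι : Type*} {P : ι → PowerSeries (H →L[ℂ] H)} {c : ι → ℂ}
    (hP : ∀ i, IsTaylorSeries A (P i)) (hc : ∀ n, Summable fun i => c i • coeff n (P i)) :
    IsTaylorSeries A (PowerSeries.mk fun n => ∑' i, c i • coeff n (P i)) := by
  intro n
  rw [coeff_mk, coeff_mk]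
  refine IsCommutator.hasSum (fun i => mem_adGraph.mp <|
    (adGraph A).smul_mem (c i) (mem_adGraph.mpr (hP i n))) (hc n).hasSum ?_
  refine ((hc (n + 1)).hasSum.const_smul (n + 1 : ℂ)).neg.congr_fun fun i => ?_
  rw [smul_neg, smul_comm]

variable [CompleteSpace H]

theorem norm_coe_unitary_le_one (U : unitary (H →L[ℂ] H)) : ‖(U : H →L[ℂ] H)‖ ≤ 1 := by
  nontriviality H
  exact (CStarRing.norm_coe_unitary U).le

theorem norm_funCalc_le (U : unitary (H →L[ℂ] H)) (f : C(Circle, ℂ)) : ‖funCalc U f‖ ≤ ‖f‖ :=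
  NonUnitalStarAlgHom.norm_apply_le (funCalc U) f

theorem continuous_funCalc (U : unitary (H →L[ℂ] H)) : Continuous (funCalc U) :=
  AddMonoidHomClass.continuous_of_bound (funCalc U) 1 fun f => by simpa using norm_funCalc_le U f

theorem funCalc_circleZPow_one (U : unitary (H →L[ℂ] H)) :
    funCalc U (circleZPow 1) = (U : H →L[ℂ] H) := by
  have hrestrict : (circleZPow 1).comp (spectrumToCircle U) =
      (ContinuousMap.id ℂ).restrict (spectrum ℂ (U : H →L[ℂ] H)) := by
    ext z
    simp only [circleZPow, zpow_one]
    rfl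
  change cfcHom _ ((circleZPow 1).comp (spectrumToCircle U)) = _
  rw [hrestrict]
  exact cfcHom_id _

theorem funCalc_circleZPow (U : unitary (H →L[ℂ] H)) (n : ℤ) :
    funCalc U (circleZPow n) = ((U ^ n : unitary (H →L[ℂ] H)) : H →L[ℂ] H) := by
  rcases n.eq_nat_or_neg with ⟨k, rfl | rfl⟩
  · have hpow : circleZPow k = circleZPow 1 ^ k := by ext z; simp [circleZPow]
    rw [hpow, map_pow, funCalc_circleZPow_one]
    simp
  · have hpow : circleZPow (-k) = star (circleZPow 1) ^ k := by
      ext z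
      simp [circleZPow, ← Circle.coe_inv_eq_conj]
    rw [hpow, map_pow, map_star, funCalc_circleZPow_one]
    simp [← Unitary.star_eq_inv]

theorem exists_isTaylorSeries_zpow (hA : IsSelfAdjoint A) {U : unitary (H →L[ℂ] H)}
    {X : PowerSeries (H →L[ℂ] H)} (hX : IsTaylorSeries A X) (hU : coeff 0 X = U) :
    ∃ P : ℤ → PowerSeries (H →L[ℂ] H), (∀ n, IsTaylorSeries A (P n)) ∧
      (∀ n, coeff 0 (P n) = ((U ^ n : unitary (H →L[ℂ] H)) : H →L[ℂ] H)) ∧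
      ∀ j, ∃ C : ℝ, ∀ n, ‖coeff j (P n)‖ ≤ C * (n.natAbs + 1 : ℝ) ^ j := by
  have hstar : coeff 0 (starSeries X) = star (U : H →L[ℂ] H) := by simp [starSeries, ← hU]
  refine ⟨fun | (k : ℕ) => X ^ k | .negSucc k => starSeries X ^ (k + 1), ?_, ?_, fun j => ?_⟩
  · rintro (k | k)
    exacts [hX.pow hA k, hX.star.pow hA (k + 1)]
  · rintro (k | k)
    · simp [coeff_zero_eq_constantCoeff_apply, ← hU]
    · rw [coeff_zero_eq_constantCoeff_apply, map_pow, ← coeff_zero_eq_constantCoeff_apply, hstar]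
      simp [zpow_negSucc, ← inv_pow, ← Unitary.star_eq_inv]
  · obtain ⟨C₁, h₁⟩ := exists_norm_coeff_pow_le
      (hU ▸ norm_coe_unitary_le_one U : ‖coeff 0 X‖ ≤ 1) j
    obtain ⟨C₂, h₂⟩ := exists_norm_coeff_pow_le (X := starSeries X)
      (by simpa [hstar] using norm_coe_unitary_le_one U) j
    refine ⟨max C₁ C₂, ?_⟩
    rintro (k | k)
    · exact (h₁ k).trans (mul_le_mul_of_nonneg_right (le_max_left _ _) (by positivity))
    · exact (h₂ (k + 1)).trans (mul_le_mul_of_nonneg_right (le_max_right _ _) (by positivity))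

theorem exists_isTaylorSeries_funCalc (hA : IsSelfAdjoint A) {U : unitary (H →L[ℂ] H)}
    {X : PowerSeries (H →L[ℂ] H)} (hX : IsTaylorSeries A X) (hU : coeff 0 X = U)
    {Φ : C(Circle, ℂ)} (hΦ : IsSmooth Φ) :
    ∃ Y, IsTaylorSeries A Y ∧ coeff 0 Y = funCalc U Φ := by
  obtain ⟨c, hc, hsum⟩ := hΦ.exists_hasSum_circleZPow
  obtain ⟨P, hP, hP0, hPj⟩ := exists_isTaylorSeries_zpow hA hX hU
  refine ⟨_, IsTaylorSeries.tsum (c := c) hP fun j => ?_, ?_⟩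
  · obtain ⟨C, hC⟩ := hPj j
    refine .of_norm_bounded ((hc j).mul_left C) fun n => ?_
    calc ‖c n • coeff j (P n)‖ ≤ ‖c n‖ * (C * (n.natAbs + 1 : ℝ) ^ j) := by
          rw [norm_smul]; gcongr; exact hC n
      _ = _ := by ring
  · simp only [coeff_mk, hP0, ← funCalc_circleZPow, ← map_smul]
    exact (hsum.map (funCalc U) (continuous_funCalc U)).tsum_eq

end SmoothFunctionalCalculus

open scoped Manifold Topology ComplexOrder

section SmoothFunctions

/-- A smooth real function on the circle, seen as a complex one. -/
def ofRealSmooth (f : C^∞⟮𝓡 1, Circle; 𝓘(ℝ), ℝ⟯) : C(Circle, ℂ) where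
  toFun z := (f z : ℂ)
  continuous_toFun := Complex.continuous_ofReal.comp f.contMDiff.continuous

theorem isSmooth_ofRealSmooth (f : C^∞⟮𝓡 1, Circle; 𝓘(ℝ), ℝ⟯) : IsSmooth (ofRealSmooth f) :=
  Complex.ofRealCLM.contDiff.comp (f.contMDiff.comp contMDiff_circleExp).contDiff

theorem tsupport_ofRealSmooth (f : C^∞⟮𝓡 1, Circle; 𝓘(ℝ), ℝ⟯) :
    tsupport (ofRealSmooth f) = tsupport f := by
  simp [tsupport, ofRealSmooth, Function.support]

theorem exists_isSmooth_eventuallyEq_one {l : Circle} {V : Set Circle} (hV : V ∈ 𝓝 l) :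
    ∃ χ : C(Circle, ℂ), IsSmooth χ ∧ tsupport χ ⊆ V ∧ χ =ᶠ[𝓝 l] 1 ∧ 0 ≤ χ ∧ χ ≤ 1 := by
  obtain ⟨f, -, hfV⟩ := (SmoothBumpFunction.nhds_basis_tsupport (I := 𝓡 1) l).mem_iff.mp hV
  refine ⟨ofRealSmooth ⟨f, f.contMDiff⟩, isSmooth_ofRealSmooth _,
    (tsupport_ofRealSmooth _).trans_subset hfV, ?_, fun z => ?_, fun z => ?_⟩
  · filter_upwards [f.eventuallyEq_one] with z hz
    exact congrArg Complex.ofReal hz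
  · exact Complex.zero_le_real.mpr f.mem_Icc.1
  · exact Complex.real_le_real.mpr f.mem_Icc.2

end SmoothFunctions

section Localization

variable {H : Type*} [NormedAddCommGroup H] [InnerProductSpace ℂ H] [CompleteSpace H]
  {U : unitary (H →L[ℂ] H)}

theorem spectralProj_le_one (U : unitary (H →L[ℂ] H)) (Θ : Set Circle) :
    spectralProj U Θ ≤ 1 := by
  rw [ContinuousLinearMap.le_def, ContinuousLinearMap.isPositive_iff_complex]
  intro ψ
  have hinner : ⟪(1 - spectralProj U Θ) ψ, ψ⟫_ℂ =
      ((‖ψ‖ ^ 2 - (spectralMeasure U ψ).real Θ : ℝ) : ℂ) := by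
    rw [← inner_conj_symm, sub_apply, inner_sub_right, inner_spectralProj, one_apply_eq_self,
      inner_self_eq_norm_sq_to_K]
    simp
  rw [hinner]
  exact ⟨rfl, sub_nonneg.mpr (spectralMeasure_real_le U Θ ψ)⟩

theorem apply_eq_zero_of_nonneg {D : H →L[ℂ] H} (hD : 0 ≤ D) {ψ : H} (h : ⟪ψ, D ψ⟫_ℂ = 0) :
    D ψ = 0 := by
  obtain ⟨S, rfl⟩ := CStarAlgebra.nonneg_iff_eq_star_mul_self.mp hD
  rw [mul_apply_eq_comp, ContinuousLinearMap.star_eq_adjoint,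
    ContinuousLinearMap.adjoint_inner_right, inner_self_eq_zero] at h
  rw [mul_apply_eq_comp, h, map_zero]

theorem norm_sq_le_spectralMeasure_real {Θ : Set Circle} (hΘ : IsOpen Θ) {χ : C(Circle, ℂ)}
    (hχ : tsupport χ ⊆ Θ) (φ : H) :
    ‖funCalc U χ φ‖ ^ 2 ≤ (spectralMeasure U (funCalc U χ φ)).real Θ := by
  obtain ⟨f, hf₀, hf₁, hf⟩ := exists_continuous_zero_one_of_isClosed hΘ.isClosed_compl
    (isClosed_tsupport χ) (Set.disjoint_compl_left_iff_subset.mpr hχ)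
  let g : C_c(Circle, ℝ) := ⟨f, HasCompactSupport.of_compactSpace f⟩
  have hmul : toComplexFun g * χ = χ := by
    ext z
    by_cases hz : z ∈ tsupport χ
    · have : g z = 1 := hf₁ hz
      simp [toComplexFun, this]
    · simp [image_eq_zero_of_notMem_tsupport hz]
  have hintegral := integral_spectralMeasure U (funCalc U χ φ) g
  rw [← mul_apply_eq_comp, ← map_mul, hmul] at hintegral
  calc ‖funCalc U χ φ‖ ^ 2 = (⟪funCalc U χ φ, funCalc U χ φ⟫_ℂ).re :=
        norm_sq_eq_re_inner (𝕜 := ℂ) _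
    _ = ∫ z, g z ∂(spectralMeasure U (funCalc U χ φ)) := hintegral.symm
    _ ≤ ∫ z, Θ.indicator 1 z ∂(spectralMeasure U (funCalc U χ φ)) := by
      refine MeasureTheory.integral_mono g.integrable
        ((MeasureTheory.integrable_const 1).indicator hΘ.measurableSet) fun z => ?_
      by_cases hz : z ∈ Θ
      · simpa [hz] using! (hf z).2
      · simpa [hz] using! (hf₀ hz).le
    _ = _ := MeasureTheory.integral_indicator_one hΘ.measurableSet

theorem spectralProj_apply_funCalc {Θ : Set Circle} (hΘ : IsOpen Θ) {χ : C(Circle, ℂ)}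
    (hχ : tsupport χ ⊆ Θ) (φ : H) :
    spectralProj U Θ (funCalc U χ φ) = funCalc U χ φ := by
  have hmass : (spectralMeasure U (funCalc U χ φ)).real Θ = ‖funCalc U χ φ‖ ^ 2 :=
    (spectralMeasure_real_le U Θ _).antisymm (norm_sq_le_spectralMeasure_real hΘ hχ φ)
  have hzero := apply_eq_zero_of_nonneg (sub_nonneg.mpr (spectralProj_le_one U Θ))
    (ψ := funCalc U χ φ) (by
      rw [sub_apply, inner_sub_right, inner_spectralProj, hmass, one_apply_eq_self,
        inner_self_eq_norm_sq_to_K]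
      simp)
  exact (sub_eq_zero.mp hzero).symm

theorem re_inner_ge_of_spectralProj_le {Θ : Set Circle} (hΘ : IsOpen Θ) {c : ℝ}
    {K C : H →L[ℂ] H}
    (h : (c : ℂ) • spectralProj U Θ + K ≤
      spectralProj U Θ * (star (U : H →L[ℂ] H) * C) * spectralProj U Θ)
    {χ : C(Circle, ℂ)} (hχ : tsupport χ ⊆ Θ) (φ : H) :
    c * ‖funCalc U χ φ‖ ^ 2 + (⟪funCalc U χ φ, K (funCalc U χ φ)⟫_ℂ).re ≤
      (⟪(U : H →L[ℂ] H) (funCalc U χ φ), C (funCalc U χ φ)⟫_ℂ).re := by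
  have hP := spectralProj_apply_funCalc (U := U) hΘ hχ φ
  have hPstar : star (spectralProj U Θ) = spectralProj U Θ := by
    simpa using (IsSelfAdjoint.of_nonneg (sub_nonneg.mpr (spectralProj_le_one U Θ))).star_eq
  set ψ := funCalc U χ φ
  have hform : ⟪ψ, (spectralProj U Θ * (star (U : H →L[ℂ] H) * C) * spectralProj U Θ) ψ⟫_ℂ =
      ⟪(U : H →L[ℂ] H) ψ, C ψ⟫_ℂ := by
    rw [mul_apply_eq_comp, hP, mul_apply_eq_comp, ← hPstar, ContinuousLinearMap.star_eq_adjoint,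
      ContinuousLinearMap.adjoint_inner_right, hP, mul_apply_eq_comp,
      ContinuousLinearMap.star_eq_adjoint, ContinuousLinearMap.adjoint_inner_right]
  have hnorm : (⟪ψ, ψ⟫_ℂ).re = ‖ψ‖ ^ 2 := inner_self_eq_norm_sq (𝕜 := ℂ) ψ
  have hpos := (ContinuousLinearMap.le_def _ _).mp h |>.re_inner_nonneg_right ψ
  rw [sub_apply, inner_sub_right, hform, add_apply, inner_add_right, smul_apply, hP,
    inner_smul_right, RCLike.re_to_complex, Complex.sub_re, Complex.add_re,
    Complex.re_ofReal_mul, hnorm] at hpos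
  linarith

theorem funCalc_circleZPow_one_sub (U : unitary (H →L[ℂ] H)) (l : ℂ) :
    funCalc U (circleZPow 1 - l • 1) = (U : H →L[ℂ] H) - l • 1 := by
  rw [map_sub, map_smul, map_one, funCalc_circleZPow_one]

theorem dense_range_sub_smul_one {l : Circle} (hl : l ∉ pointSpectrum U) :
    Dense (((U : H →L[ℂ] H) - (l : ℂ) • 1).range : Set H) := by
  have hnormal : IsStarNormal ((U : H →L[ℂ] H) - (l : ℂ) • 1) := by
    rw [← funCalc_circleZPow_one_sub]
    infer_instance
  rw [Submodule.dense_iff_topologicalClosure_eq_top, Submodule.topologicalClosure_eq_top_iff,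
    ContinuousLinearMap.IsStarNormal.orthogonal_range hnormal]
  rw [pointSpectrum, Set.mem_ofPred_eq, Module.End.hasEigenvalue_iff, not_not,
    Module.End.eigenspace_def] at hl
  exact hl

theorem eventually_norm_funCalc_apply_lt {l : Circle} (hl : l ∉ pointSpectrum U) (ψ : H) {δ : ℝ}
    (hδ : 0 < δ) : ∀ᶠ V in (𝓝 l).smallSets, ∀ χ : C(Circle, ℂ),
      ‖χ‖ ≤ 1 → tsupport χ ⊆ V → ‖funCalc U χ ψ‖ < δ := by
  obtain ⟨_, ⟨x, rfl⟩, hx⟩ := Metric.dense_iff.mp (dense_range_sub_smul_one hl) ψ (δ / 2)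
    (by positivity) |>.imp fun _ h => h.symm
  set D := (U : H →L[ℂ] H) - (l : ℂ) • 1 with hD
  set η := δ / (2 * (‖x‖ + 1))
  filter_upwards [Filter.eventually_smallSets_subset.mpr
    (Metric.closedBall_mem_nhds l (show 0 < η by positivity))] with V hV χ hχ hχV
  have hsmall : ‖χ * (circleZPow 1 - (l : ℂ) • 1)‖ ≤ η := by
    refine (ContinuousMap.norm_le _ (by positivity)).mpr fun z => ?_
    by_cases hz : z ∈ tsupport χ
    · calc ‖(χ * (circleZPow 1 - (l : ℂ) • 1)) z‖ = ‖χ z‖ * dist z l := by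
            simp [circleZPow, show dist z l = ‖(z : ℂ) - l‖ from dist_eq_norm (z : ℂ) l]
        _ ≤ 1 * η := by
          gcongr
          exacts [(χ.norm_coe_le_norm z).trans hχ, hV (hχV hz)]
        _ = η := one_mul η
    · simp only [ContinuousMap.mul_apply, image_eq_zero_of_notMem_tsupport hz, zero_mul, norm_zero]
      positivity
  have hrange : ‖funCalc U χ (D x)‖ < δ / 2 := by
    rw [hD, ← funCalc_circleZPow_one_sub, ← mul_apply_eq_comp, ← map_mul]
    calc _ ≤ η * ‖x‖ := ContinuousLinearMap.le_of_opNorm_le _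
          ((norm_funCalc_le U _).trans hsmall) x
      _ < η * (‖x‖ + 1) := by gcongr; linarith
      _ = δ / 2 := by simp only [η]; field_simp
  calc ‖funCalc U χ ψ‖ = ‖funCalc U χ (D x) + funCalc U χ (ψ - D x)‖ := by
        rw [← map_add, add_sub_cancel]
    _ ≤ ‖funCalc U χ (D x)‖ + 1 * ‖ψ - D x‖ := (norm_add_le _ _).trans <| by
        gcongr; exact ContinuousLinearMap.le_of_opNorm_le _ ((norm_funCalc_le U χ).trans hχ) _
    _ < δ / 2 + 1 * (δ / 2) := by
      gcongr
      rwa [← dist_eq_norm, dist_comm]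
    _ = δ := by ring

theorem eventually_norm_funCalc_mul_le {l : Circle} (hl : l ∉ pointSpectrum U) {K : H →L[ℂ] H}
    (hK : IsCompactOperator K) {δ : ℝ} (hδ : 0 < δ) :
    ∀ᶠ V in (𝓝 l).smallSets, ∀ χ : C(Circle, ℂ),
      ‖χ‖ ≤ 1 → tsupport χ ⊆ V → ‖funCalc U χ * K‖ ≤ δ := by
  obtain ⟨t, htfin, ht⟩ := Metric.totallyBounded_iff.mp
    ((hK.isCompact_closure_image_closedBall 1).totallyBounded.subset subset_closure) (δ / 2)
    (by positivity)
  filter_upwards [htfin.eventually_all.mpr fun y _ =>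
    eventually_norm_funCalc_apply_lt hl y (half_pos hδ)] with V hV χ hχ hχV
  refine ContinuousLinearMap.opNorm_le_of_unit_norm hδ.le fun x hx => ?_
  obtain ⟨y, hy, hxy⟩ := Set.mem_iUnion₂.mp (ht ⟨x, by simp [hx], rfl⟩)
  calc ‖funCalc U χ (K x)‖ = ‖funCalc U χ y + funCalc U χ (K x - y)‖ := by
        rw [← map_add, add_sub_cancel]
    _ ≤ ‖funCalc U χ y‖ + 1 * ‖K x - y‖ := (norm_add_le _ _).trans <| by
        gcongr; exact ContinuousLinearMap.le_of_opNorm_le _ ((norm_funCalc_le U χ).trans hχ) _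
    _ ≤ δ / 2 + 1 * (δ / 2) := by
      gcongr
      exacts [(hV y hy χ hχ hχV).le, (mem_ball_iff_norm.mp hxy).le]
    _ = δ := by ring

end Localization

section MourreEstimate

variable {H : Type*} [NormedAddCommGroup H] [InnerProductSpace ℂ H] [CompleteSpace H]
  {A : H →ₗ.[ℂ] H} {U : unitary (H →L[ℂ] H)}

theorem tsupport_star (Φ : C(Circle, ℂ)) : tsupport (star Φ) = tsupport Φ := by
  simp [tsupport, Function.support]

/-- The Mourre estimate `T⋆ U⋆ [A, U] T ≥ c T⋆ T - c / 4` for a spectral cutoff `T` of `U`, whose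
error term is not compact but small. -/
def HasMourreEstimate (A : H →ₗ.[ℂ] H) (U : unitary (H →L[ℂ] H)) (T : H →L[ℂ] H) (c : ℝ) : Prop :=
  ∀ φ, c * ‖T φ‖ ^ 2 - c / 4 * ‖φ‖ ^ 2 ≤
    (⟪(U : H →L[ℂ] H) (T φ), ad A (U : H →L[ℂ] H) (T φ)⟫_ℂ).re

theorem abs_re_inner_funCalc_le {χ : C(Circle, ℂ)} (hχ : ‖χ‖ ≤ 1) {K : H →L[ℂ] H} {δ : ℝ}
    (hK : ‖funCalc U (star χ) * K‖ ≤ δ) (φ : H) :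
    |(⟪funCalc U χ φ, K (funCalc U χ φ)⟫_ℂ).re| ≤ δ * ‖φ‖ ^ 2 := by
  have hφ : ‖funCalc U χ φ‖ ≤ 1 * ‖φ‖ :=
    ContinuousLinearMap.le_of_opNorm_le _ ((norm_funCalc_le U χ).trans hχ) φ
  calc |(⟪funCalc U χ φ, K (funCalc U χ φ)⟫_ℂ).re|
      ≤ ‖⟪funCalc U χ φ, K (funCalc U χ φ)⟫_ℂ‖ := Complex.abs_re_le_norm _
    _ = ‖⟪φ, (funCalc U (star χ) * K) (funCalc U χ φ)⟫_ℂ‖ := by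
      rw [mul_apply_eq_comp, map_star, ContinuousLinearMap.star_eq_adjoint,
        ContinuousLinearMap.adjoint_inner_right]
    _ ≤ ‖φ‖ * (δ * (1 * ‖φ‖)) := (norm_inner_le_norm _ _).trans <| by
      gcongr
      exact (ContinuousLinearMap.le_of_opNorm_le _ hK _).trans
        (mul_le_mul_of_nonneg_left hφ ((norm_nonneg _).trans hK))
    _ = δ * ‖φ‖ ^ 2 := by ring

theorem IsPropagating.exists_eventually_hasMourreEstimate {Θ : Set Circle}
    (hprop : IsPropagating A U Θ) (hΘ : IsOpen Θ) :
    ∃ c, 0 < c ∧ ∀ l ∈ Θ \ pointSpectrum U, ∀ᶠ V in (𝓝 l).smallSets, ∀ χ : C(Circle, ℂ),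
      ‖χ‖ ≤ 1 → tsupport χ ⊆ V → HasMourreEstimate A U (funCalc U χ) c := by
  obtain ⟨-, c, hc, K, hK, hle⟩ := hprop
  refine ⟨c, hc, fun l hl => ?_⟩
  filter_upwards [Filter.eventually_smallSets_subset.mpr (hΘ.mem_nhds hl.1),
    eventually_norm_funCalc_mul_le hl.2 hK (show 0 < c / 4 by positivity)]
    with V hVΘ hKV χ hχ hχV φ
  have hmourre := re_inner_ge_of_spectralProj_le hΘ hle (hχV.trans hVΘ) φ
  have hcompact := abs_re_inner_funCalc_le hχ
    (hKV (star χ) ((norm_star χ).trans_le hχ) ((tsupport_star χ).trans_subset hχV)) φ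
  linarith [neg_le_of_abs_le hcompact]

end MourreEstimate

section LocalContraction

open PowerSeries

variable {H : Type*} [NormedAddCommGroup H] [InnerProductSpace ℂ H] [CompleteSpace H]
  {A : H →ₗ.[ℂ] H} {U : unitary (H →L[ℂ] H)} {T S : H →L[ℂ] H} {c : ℝ}

theorem re_inner_eq_zero_of_star_eq_neg (hS : star S = -S) (ψ : H) : (⟪ψ, S ψ⟫_ℂ).re = 0 := by
  have hneg : ⟪ψ, S ψ⟫_ℂ = -(starRingEnd ℂ) ⟪ψ, S ψ⟫_ℂ := by
    rw [inner_conj_symm, ← inner_neg_left, ← neg_apply, ← hS, ContinuousLinearMap.star_eq_adjoint,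
      ContinuousLinearMap.adjoint_inner_left]
  have hre := congrArg Complex.re hneg
  rw [Complex.neg_re, Complex.conj_re] at hre
  linarith

theorem norm_sq_add_norm_sub_sq_le (hT₀ : 0 ≤ T) (hT₁ : T ≤ 1) (ψ : H) :
    ‖T ψ‖ ^ 2 + ‖ψ - T ψ‖ ^ 2 ≤ ‖ψ‖ ^ 2 := by
  have hsq : T ^ 2 ≤ T := by simpa using CStarAlgebra.pow_antitone hT₀ hT₁ one_le_two
  have hcross : 0 ≤ RCLike.re ⟪T ψ, ψ - T ψ⟫_ℂ := by
    have hpos := ((ContinuousLinearMap.le_def _ _).mp hsq).re_inner_nonneg_right ψ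
    rwa [← (IsSelfAdjoint.of_nonneg hT₀).star_eq, ContinuousLinearMap.star_eq_adjoint,
      ContinuousLinearMap.adjoint_inner_left, ← ContinuousLinearMap.star_eq_adjoint,
      (IsSelfAdjoint.of_nonneg hT₀).star_eq, map_sub, ← mul_apply_eq_comp, ← sq]
  have hexpand := norm_add_sq (𝕜 := ℂ) (T ψ) (ψ - T ψ)
  rw [add_sub_cancel] at hexpand
  linarith

theorem re_inner_mul_sub_le (hS : star S = -S) (hM : HasMourreEstimate A U T c) (ψ : H) :
    (⟪(U : H →L[ℂ] H) (T ψ), ((U : H →L[ℂ] H) * S - ad A (U : H →L[ℂ] H) * T) ψ⟫_ℂ).re ≤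
      ‖ψ - T ψ‖ * (‖S‖ * ‖ψ‖) - (c * ‖T ψ‖ ^ 2 - c / 4 * ‖ψ‖ ^ 2) := by
  have hskew : (⟪T ψ, S ψ⟫_ℂ).re = -(⟪ψ - T ψ, S ψ⟫_ℂ).re := by
    rw [inner_sub_left, Complex.sub_re, re_inner_eq_zero_of_star_eq_neg hS]
    ring
  have hcross : -(⟪ψ - T ψ, S ψ⟫_ℂ).re ≤ ‖ψ - T ψ‖ * (‖S‖ * ‖ψ‖) :=
    calc -(⟪ψ - T ψ, S ψ⟫_ℂ).re ≤ ‖⟪ψ - T ψ, S ψ⟫_ℂ‖ :=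
          (neg_le_abs _).trans (Complex.abs_re_le_norm _)
      _ ≤ ‖ψ - T ψ‖ * ‖S ψ‖ := norm_inner_le_norm _ _
      _ ≤ _ := by gcongr; exact S.le_opNorm ψ
  rw [sub_apply, inner_sub_right, mul_apply_eq_comp, mul_apply_eq_comp,
    ContinuousLinearMap.inner_map_map_of_mem_unitary U.2, Complex.sub_re, hskew]
  linarith [hM ψ]

theorem norm_add_smul_apply_sq_le (hT₀ : 0 ≤ T) (hT₁ : T ≤ 1) (hS : star S = -S)
    (hM : HasMourreEstimate A U T c) {V : H →L[ℂ] H}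
    (hV : V = (U : H →L[ℂ] H) * S - ad A (U : H →L[ℂ] H) * T) {ε : ℝ} (hε₀ : 0 ≤ ε)
    (hε : 4 * c * ε ≤ 1) (ψ : H) :
    ‖((U : H →L[ℂ] H) * T + (ε : ℂ) • V) ψ‖ ^ 2 ≤
      (1 - 3 / 2 * c * ε + (2 * ‖S‖ ^ 2 + ‖V‖ ^ 2) * ε ^ 2) * ‖ψ‖ ^ 2 := by
  have hcross := mul_le_mul_of_nonneg_left (hV ▸ re_inner_mul_sub_le hS hM ψ) hε₀
  have hsecond : ‖(ε : ℂ) • V ψ‖ ^ 2 ≤ (ε * (‖V‖ * ‖ψ‖)) ^ 2 := by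
    rw [norm_smul, Complex.norm_real, Real.norm_of_nonneg hε₀]
    gcongr
    exact V.le_opNorm ψ
  have hexpand := norm_add_sq (𝕜 := ℂ) ((U : H →L[ℂ] H) (T ψ)) ((ε : ℂ) • V ψ)
  rw [ContinuousLinearMap.norm_map_of_mem_unitary U.2, inner_smul_right, RCLike.re_to_complex,
    Complex.re_ofReal_mul] at hexpand
  -- AM-GM absorbs the cross term between `ψ - T ψ` and `S ψ` into `‖ψ - T ψ‖ ^ 2`.
  have hamgm : 2 * (ε * (‖ψ - T ψ‖ * (‖S‖ * ‖ψ‖))) ≤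
      ‖ψ - T ψ‖ ^ 2 / 2 + 2 * ‖S‖ ^ 2 * ε ^ 2 * ‖ψ‖ ^ 2 := by
    linarith [sq_nonneg (‖ψ - T ψ‖ - 2 * ε * ‖S‖ * ‖ψ‖)]
  have hpyth := mul_le_mul_of_nonneg_left (norm_sq_add_norm_sub_sq_le hT₀ hT₁ ψ)
    (show 0 ≤ 1 - 2 * c * ε by linarith)
  have hhalf : ‖ψ - T ψ‖ ^ 2 / 2 ≤ (1 - 2 * c * ε) * ‖ψ - T ψ‖ ^ 2 := by
    linarith [mul_nonneg (sub_nonneg.mpr hε) (sq_nonneg ‖ψ - T ψ‖)]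
  rw [add_apply, smul_apply, mul_apply_eq_comp, hexpand]
  linarith

theorem eventually_norm_add_smul_le (hT₀ : 0 ≤ T) (hT₁ : T ≤ 1) (hS : star S = -S) (hc : 0 < c)
    (hM : HasMourreEstimate A U T c) {V : H →L[ℂ] H}
    (hV : V = (U : H →L[ℂ] H) * S - ad A (U : H →L[ℂ] H) * T) :
    ∀ᶠ ε : ℝ in 𝓝[≥] 0, ‖(U : H →L[ℂ] H) * T + (ε : ℂ) • V‖ ≤ 1 - c / 2 * ε := by
  have hsmall (a b : ℝ) (hb : 0 < b) : ∀ᶠ ε : ℝ in 𝓝[≥] 0, a * ε ≤ b := by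
    have hcont : Filter.Tendsto (fun ε : ℝ => a * ε) (𝓝 0) (𝓝 0) :=
      Continuous.tendsto' (by fun_prop) 0 0 (mul_zero a)
    exact (hcont.eventually_le_const hb).filter_mono nhdsWithin_le_nhds
  filter_upwards [self_mem_nhdsWithin, hsmall (4 * c) 1 one_pos,
    hsmall (2 * ‖S‖ ^ 2 + ‖V‖ ^ 2) (c / 2) (by positivity)] with ε hε₀ hε hε'
  replace hε₀ : 0 ≤ ε := hε₀
  have hnonneg : 0 ≤ 1 - c / 2 * ε := by nlinarith
  refine ContinuousLinearMap.opNorm_le_bound _ hnonneg fun ψ => ?_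
  refine (sq_le_sq₀ (norm_nonneg _) (by positivity)).mp ?_
  calc _ ≤ _ := norm_add_smul_apply_sq_le hT₀ hT₁ hS hM hV hε₀ hε ψ
    _ ≤ (1 - c / 2 * ε) ^ 2 * ‖ψ‖ ^ 2 := by
      gcongr
      nlinarith [sq_nonneg (c * ε), mul_le_mul_of_nonneg_right hε' hε₀]
    _ = _ := (mul_pow _ _ 2).symm

theorem hasDerivAt_truncEval_zero {N : ℕ} (hN : 1 ≤ N) (Z : PowerSeries (H →L[ℂ] H)) :
    HasDerivAt (truncEval N Z) (coeff 1 Z) 0 :=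
  (hasDerivAt_truncEval N Z 0).congr_deriv <| by
    simp [truncEvalDeriv, truncError, Finset.sum_range_succ', (Nat.one_le_iff_ne_zero.mp hN)]

theorem exists_norm_truncEval_le_exp {N : ℕ} (hN : 1 ≤ N) {Z : PowerSeries (H →L[ℂ] H)} {a b : ℝ}
    (hba : b < a) (hZ : ∀ᶠ ε : ℝ in 𝓝[≥] 0, ‖coeff 0 Z + (ε : ℂ) • coeff 1 Z‖ ≤ 1 - a * ε) :
    ∃ ε₀ : ℝ, 0 < ε₀ ∧ ∀ ε ∈ Set.Icc 0 ε₀, ‖truncEval N Z ε‖ ≤ Real.exp (-(b * ε)) := by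
  have hrem := (hasDerivAt_iff_isLittleO.mp (hasDerivAt_truncEval_zero hN Z)).def
    (sub_pos.mpr hba)
  have hbound : ∀ᶠ ε : ℝ in 𝓝[≥] 0, ‖truncEval N Z ε‖ ≤ Real.exp (-(b * ε)) := by
    filter_upwards [hZ, hrem.filter_mono nhdsWithin_le_nhds, self_mem_nhdsWithin]
      with ε hlin hrem hε
    rw [sub_zero, truncEval_zero, Real.norm_of_nonneg hε] at hrem
    calc ‖truncEval N Z ε‖ = ‖(coeff 0 Z + (ε : ℂ) • coeff 1 Z) +
          (truncEval N Z ε - coeff 0 Z - ε • coeff 1 Z)‖ := by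
          congr 1
          rw [Complex.coe_smul]
          abel
      _ ≤ (1 - a * ε) + (a - b) * ε := norm_add_le_of_le hlin hrem
      _ = 1 - b * ε := by ring
      _ ≤ Real.exp (-(b * ε)) := Real.one_sub_le_exp_neg _
  obtain ⟨ε₀, hε₀, hsub⟩ := mem_nhdsGE_iff_exists_Icc_subset.mp hbound
  exact ⟨ε₀, hε₀, fun ε hε => hsub hε⟩

theorem HasMourreEstimate.exists_norm_truncEval_mul_le (hA : IsSelfAdjoint A) (hT₀ : 0 ≤ T)
    (hT₁ : T ≤ 1) (hc : 0 < c) (hM : HasMourreEstimate A U T c)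
    {X Y : PowerSeries (H →L[ℂ] H)} (hX₀ : coeff 0 X = (U : H →L[ℂ] H))
    (hX₁ : coeff 1 X = -ad A (U : H →L[ℂ] H)) (hY : IsTaylorSeries A Y) (hY₀ : coeff 0 Y = T)
    {N : ℕ} (hN : 1 ≤ N) :
    ∃ ε₀ : ℝ, 0 < ε₀ ∧
      ∀ ε ∈ Set.Icc 0 ε₀, ‖truncEval N (X * Y) ε‖ ≤ Real.exp (-(c / 4 * ε)) := by
  have hcomm : IsCommutator A T (-coeff 1 Y) := by simpa [hY₀] using hY 0
  have hskew : star (coeff 1 Y) = -coeff 1 Y := by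
    have hstar := hcomm.star
    rw [(IsSelfAdjoint.of_nonneg hT₀).star_eq, star_neg, neg_neg] at hstar
    exact hstar.unique hA hcomm
  have hcoeff₀ : coeff 0 (X * Y) = (U : H →L[ℂ] H) * T := by simp [coeff_mul, hX₀, hY₀]
  have hcoeff₁ : coeff 1 (X * Y) =
      (U : H →L[ℂ] H) * coeff 1 Y - ad A (U : H →L[ℂ] H) * T := by
    rw [coeff_mul, Finset.Nat.antidiagonal_succ]
    simp [hX₀, hX₁, hY₀, sub_eq_add_neg]
  refine exists_norm_truncEval_le_exp hN (a := c / 2) (by linarith) ?_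
  rw [hcoeff₀]
  exact eventually_norm_add_smul_le hT₀ hT₁ hskew hc hM hcoeff₁

end LocalContraction

section PartitionOfUnity

theorem IsSmooth.mul {Φ Ψ : C(Circle, ℂ)} (hΦ : IsSmooth Φ) (hΨ : IsSmooth Ψ) :
    IsSmooth (Φ * Ψ) :=
  ContDiff.mul hΦ hΨ

theorem IsSmooth.exists_eq_sum {Φ : C(Circle, ℂ)} (hΦ : IsSmooth Φ) {V : Circle → Set Circle}
    (hV : ∀ l ∈ tsupport Φ, V l ∈ 𝓝 l) :
    ∃ (t : Finset Circle) (Ψ : t → C(Circle, ℂ)), Φ = ∑ l, Ψ l ∧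
      ∀ l : t, (l : Circle) ∈ tsupport Φ ∧ IsSmooth (Ψ l) ∧ tsupport (Ψ l) ⊆ V l := by
  have hclosed : IsClosed (tsupport Φ) := isClosed_tsupport Φ
  obtain ⟨t, htΦ, ht⟩ := hclosed.isCompact.elim_nhds_subcover (fun l => interior (V l))
    fun l hl => interior_mem_nhds.mpr (hV l hl)
  obtain ⟨f, hf⟩ := SmoothPartitionOfUnity.exists_isSubordinate (𝓡 1) hclosed
    (fun l : t => interior (V l)) (fun _ => isOpen_interior)
    (ht.trans_eq (Set.biUnion_eq_iUnion _ _))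
  refine ⟨t, fun l => ofRealSmooth (f l) * Φ, ?_, fun l => ⟨htΦ l l.2,
    (isSmooth_ofRealSmooth _).mul hΦ, ?_⟩⟩
  · ext z
    by_cases hz : z ∈ tsupport Φ
    · have hsum : ∑ l, f l z = 1 := by rw [← finsum_eq_sum_of_fintype, f.sum_eq_one hz]
      have hsumC : ∑ l, ofRealSmooth (f l) z = 1 :=
        (Complex.ofReal_sum _ _).symm.trans (congrArg Complex.ofReal hsum)
      rw [← Finset.sum_mul, ContinuousMap.mul_apply, ContinuousMap.sum_apply, hsumC, one_mul]
    · simp [image_eq_zero_of_notMem_tsupport hz]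
  · calc tsupport (ofRealSmooth (f l) * Φ) ⊆ tsupport (ofRealSmooth (f l)) :=
          tsupport_mul_subset_left
      _ = tsupport (f l) := tsupport_ofRealSmooth _
      _ ⊆ V l := (hf l).trans interior_subset

theorem IsSmoothWithSupportIn.star {Φ : C(Circle, ℂ)} {S : Set Circle}
    (hΦ : IsSmoothWithSupportIn Φ S) : IsSmoothWithSupportIn (star Φ) S :=
  ⟨(Complex.conjCLE.contDiff.comp hΦ.1 :), (tsupport_star Φ).trans_subset hΦ.2⟩

end PartitionOfUnity

section Decay

variable {H : Type*} [NormedAddCommGroup H] [InnerProductSpace ℂ H] [CompleteSpace H]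
  {A : H →ₗ.[ℂ] H} {U : unitary (H →L[ℂ] H)} {Θ : Set Circle} {Φ : C(Circle, ℂ)}

theorem mul_pow_mul_eq_of_mul_eq {R : Type*} [CommMonoid R] {χ Φ : R} (h : χ * Φ = Φ) (u : R)
    (m : ℕ) : (u * χ) ^ m * Φ = u ^ m * Φ := by
  have hpow : χ ^ m * Φ = Φ := by
    induction m with
    | zero => simp
    | succ m ih => rw [pow_succ, mul_assoc, h, ih]
  rw [mul_pow, mul_assoc, hpow]

theorem HasMourreEstimate.hasDecay (hA : IsSelfAdjoint A) (hU : IsCinfty A (U : H →L[ℂ] H))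
    {c : ℝ} (hc : 0 < c) {χ : C(Circle, ℂ)} (hχ : IsSmooth χ) (hχ₀ : 0 ≤ χ) (hχ₁ : χ ≤ 1)
    (hM : HasMourreEstimate A U (funCalc U χ) c) (hΦ : IsSmooth Φ) (hχΦ : χ * Φ = Φ)
    {n : ℕ} (hn : 1 ≤ n) :
    HasDecay A (fun m => (U : H →L[ℂ] H) ^ m * funCalc U Φ) (2 * n) (2 * n) := by
  obtain ⟨X, hX, hX₀, hX₁⟩ := hU.exists_isTaylorSeries
  obtain ⟨Y, hY, hY₀⟩ := exists_isTaylorSeries_funCalc hA hX hX₀ hχ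
  obtain ⟨Z, hZ, hZ₀⟩ := exists_isTaylorSeries_funCalc hA hX hX₀ hΦ
  have hT₀ : 0 ≤ funCalc U χ := map_nonneg (funCalc U) hχ₀
  have hT₁ : funCalc U χ ≤ 1 := by simpa using OrderHomClass.mono (funCalc U) hχ₁
  obtain ⟨ε₀, hε₀, hcontr⟩ := hM.exists_norm_truncEval_mul_le hA hT₀ hT₁ hc hX₀ hX₁ hY hY₀
    (show 1 ≤ 2 * n by lia)
  have hcoeff : PowerSeries.coeff 0 (X * Y) = funCalc U (circleZPow 1 * χ) := by
    rw [map_mul (funCalc U), funCalc_circleZPow_one, ← hX₀, ← hY₀]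
    simp [PowerSeries.coeff_mul]
  have hpow (m : ℕ) : PowerSeries.coeff 0 (X * Y) ^ m * PowerSeries.coeff 0 Z =
      (U : H →L[ℂ] H) ^ m * funCalc U Φ := by
    rw [hcoeff, hZ₀, ← map_pow, ← map_mul, mul_pow_mul_eq_of_mul_eq hχΦ, map_mul, map_pow,
      funCalc_circleZPow_one]
  simpa only [hpow] using
    hasDecay_pow_mul_of_norm_truncEval_le hA (hX.mul hA hY) hZ hn (by positivity) hε₀ hcontr

theorem IsPropagating.exists_mem_nhds_hasDecay (hprop : IsPropagating A U Θ) (hΘ : IsOpen Θ)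
    (hA : IsSelfAdjoint A) (hU : IsCinfty A (U : H →L[ℂ] H)) {l : Circle}
    (hl : l ∈ Θ \ pointSpectrum U) :
    ∃ V ∈ 𝓝 l, ∀ Φ : C(Circle, ℂ), IsSmooth Φ → tsupport Φ ⊆ V → ∀ n : ℕ, 1 ≤ n →
      HasDecay A (fun m => (U : H →L[ℂ] H) ^ m * funCalc U Φ) (2 * n) (2 * n) := by
  obtain ⟨c, hc, hmourre⟩ := hprop.exists_eventually_hasMourreEstimate hΘ
  obtain ⟨W, hW, hM⟩ := (hmourre l hl).exists_mem_of_smallSets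
  obtain ⟨χ, hχ, hχW, hχl, hχ₀, hχ₁⟩ := exists_isSmooth_eventuallyEq_one hW
  have hnorm : ‖χ‖ ≤ 1 := (CStarAlgebra.norm_le_one_iff_of_nonneg χ hχ₀).mpr hχ₁
  refine ⟨{z | χ z = 1}, hχl, fun Φ hΦ hΦχ n hn =>
    (hM χ hnorm hχW).hasDecay hA hU hc hχ hχ₀ hχ₁ hΦ ?_ hn⟩
  ext z
  by_cases hz : z ∈ tsupport Φ
  · have hχz : χ z = 1 := hΦχ hz
    simp [hχz]
  · simp [image_eq_zero_of_notMem_tsupport hz]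

theorem IsPropagating.hasDecay (hprop : IsPropagating A U Θ) (hΘ : IsOpen Θ)
    (hA : IsSelfAdjoint A) (hU : IsCinfty A (U : H →L[ℂ] H))
    (hΦ : IsSmoothWithSupportIn Φ (Θ \ pointSpectrum U)) {s' s : ℝ} (hs' : 0 < s') (hs : s' < s) :
    HasDecay A (fun m => (U : H →L[ℂ] H) ^ m * funCalc U Φ) s s' := by
  have hlocal := fun l (hl : l ∈ tsupport Φ) =>
    hprop.exists_mem_nhds_hasDecay hΘ hA hU (hΦ.2 hl)
  choose! V hV hdecay using hlocal
  obtain ⟨t, Ψ, hsum, hΨ⟩ := IsSmooth.exists_eq_sum hΦ.1 hV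
  have hbound (m : ℕ) : ‖(U : H →L[ℂ] H) ^ m * funCalc U Φ‖ ≤ ‖funCalc U Φ‖ :=
    (norm_mul_le _ _).trans <|
      mul_le_of_le_one_left (norm_nonneg _) (norm_coe_unitary_le_one (U ^ m))
  refine hasDecay_of_forall_even hbound (fun n hn => ?_) hs' hs
  simp only [hsum, map_sum, Finset.mul_sum]
  exact HasDecay.sum fun l _ => hdecay l (hΨ l).1 (Ψ l) (hΨ l).2.1 (hΨ l).2.2 n hn

end Decay

section Bracket

variable {H : Type*} [NormedAddCommGroup H] [InnerProductSpace ℂ H] [CompleteSpace H]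
  {A : H →ₗ.[ℂ] H} {U : unitary (H →L[ℂ] H)} {Φ : C(Circle, ℂ)}

theorem natAbs_add_one_rpow_neg_le (m : ℤ) {s : ℝ} (hs : 0 ≤ s) :
    (m.natAbs + 1 : ℝ) ^ (-s) ≤ bracket m ^ (-s) := by
  have hpos : 0 < bracket m := Real.sqrt_pos.mpr (by positivity)
  have hle : bracket m ≤ m.natAbs + 1 := by
    rw [bracket, Real.sqrt_le_left (by positivity), Nat.cast_natAbs, Int.cast_abs]
    nlinarith [sq_abs (m : ℝ), abs_nonneg (m : ℝ)]
  exact Real.rpow_le_rpow_of_nonpos hpos hle (neg_nonpos.mpr hs)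

theorem HasDecay.exists_norm_le_bracket {T : ℕ → H →L[ℂ] H} {s q : ℝ} (h : HasDecay A T s q)
    (hq : 0 ≤ q) : ∃ C, 0 < C ∧ ∀ m : ℤ,
      ‖bracketNegPow A s * T m.natAbs * bracketNegPow A s‖ ≤ C * bracket m ^ (-q) := by
  obtain ⟨C, hC, hbound⟩ := h.exists_pos
  refine ⟨C, hC, fun m => (Asymptotics.isBigOWith_top.mp hbound m.natAbs).trans ?_⟩
  rw [Real.norm_of_nonneg (by positivity)]
  exact mul_le_mul_of_nonneg_left (natAbs_add_one_rpow_neg_le m hq) hC.le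

theorem star_bracketNegPow_mul_pow_mul_funCalc (s : ℝ) (m : ℕ) :
    star (bracketNegPow A s * ((U : H →L[ℂ] H) ^ m * funCalc U (star Φ)) * bracketNegPow A s) =
      bracketNegPow A s * ((U ^ (-m : ℤ) : unitary (H →L[ℂ] H)) : H →L[ℂ] H) * funCalc U Φ *
        bracketNegPow A s := by
  have hcomm : funCalc U Φ * star ((U : H →L[ℂ] H) ^ m) =
      ((U ^ (-m : ℤ) : unitary (H →L[ℂ] H)) : H →L[ℂ] H) * funCalc U Φ := by
    have hstar : star ((U : H →L[ℂ] H) ^ m) = funCalc U (circleZPow (-m)) := by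
      rw [funCalc_circleZPow, zpow_neg, zpow_natCast]
      rfl
    rw [hstar, ← funCalc_circleZPow, ← map_mul, ← map_mul, mul_comm]
  rw [map_star, star_mul, star_mul, star_mul, star_star, (isSelfAdjoint_bracketNegPow s).star_eq,
    hcomm]
  simp only [mul_assoc]

end Bracket

end UnitaryMourre

end

open UnitaryMourre

theorem corollary2p4 {H : Type*} [NormedAddCommGroup H] [InnerProductSpace ℂ H] [CompleteSpace H]
    (A : H →ₗ.[ℂ] H) (hA : IsSelfAdjoint A)
    (U : unitary (H →L[ℂ] H)) (hU : UnitaryMourre.IsCinfty A (U : H →L[ℂ] H))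
    (Θ : Set Circle) (hΘ : IsOpen Θ) (hprop : UnitaryMourre.IsPropagating A U Θ)
    (Φ : C(Circle, ℂ))
    (hΦ : UnitaryMourre.IsSmoothWithSupportIn Φ (Θ \ UnitaryMourre.pointSpectrum U))
    (s' s : ℝ) (hs' : 0 < s') (hs : s' < s) :
    ∃ C : ℝ, 0 < C ∧ ∀ m : ℤ,
      ‖UnitaryMourre.bracketNegPow A s * ((U ^ m : unitary (H →L[ℂ] H)) : H →L[ℂ] H) *
          UnitaryMourre.funCalc U Φ * UnitaryMourre.bracketNegPow A s‖
        ≤ C * UnitaryMourre.bracket m ^ (-s') := by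
  obtain ⟨C₁, hC₁, hpos⟩ := (hprop.hasDecay hΘ hA hU hΦ hs' hs).exists_norm_le_bracket hs'.le
  obtain ⟨C₂, -, hneg⟩ := (hprop.hasDecay hΘ hA hU hΦ.star hs' hs).exists_norm_le_bracket hs'.le
  refine ⟨max C₁ C₂, lt_max_of_lt_left hC₁, fun m => ?_⟩
  have hbracket : 0 ≤ bracket m ^ (-s') := Real.rpow_nonneg (Real.sqrt_nonneg _) _
  rcases m.eq_nat_or_neg with ⟨k, rfl | rfl⟩
  · refine le_trans ?_ (mul_le_mul_of_nonneg_right (le_max_left C₁ C₂) hbracket)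
    simpa [mul_assoc] using hpos k
  · refine le_trans ?_ (mul_le_mul_of_nonneg_right (le_max_right C₁ C₂) hbracket)
    rw [← star_bracketNegPow_mul_pow_mul_funCalc, norm_star]
    simpa using hneg (-k)
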